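/- Let $N\in\mathbb N$. Let $P=\mathbb C[x,y,z,w]$, and let $P_n$ be its subspace of homogeneous polynomials of degree $n$ (including $0$). Define the linear maps $L_1=D_xD_y-D_zD_w$ and $R_1=M_xM_y-M_zM_w$ on $P$, where $D_a$ is the partial derivative with respect to $a$ and $M_a$ is multiplication by $a$. Equip $P$ with the Hermitian form for which the monomials are mutually orthogonal and $\|x^ry^sz^tw^u\|^2=r!\,s!\,t!\,u!$. Let $X=\{1,-1\}^N$ be the vertex set of the hypercube $H(N,2)$ (two vertices are adjacent when they differ in exactly one coordinate), let $\partial$ be the path-length distance, and let $V$ be the complex vector space with basis $X$. Fix $\varkappa\in X$. Define $A,A^*\in\mathrm{End}(V)$ by $Ax=\sum_{\xi\sim x}\xi$ and $A^*x=(N-2\partial(x,\varkappa))\,x$ for $x\in X$, and let $T$ be the (unital) subalgebra of $\mathrm{End}(V)$ generated by $A,A^*$. For $x,y\in X$ let $e_{x,y}\in\mathrm{End}(V)$ send $y\mapsto x$ and every other vertex to $0$; equip $\mathrm{End}(V)$ with the Hermitian form for which the $e_{x,y}$ are orthonormal. Put $$\phi=\tfrac18\bigl(4A^2+4A^{*2}-(AA^*-A^*A)^2\bigr),\qquad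 \lambda_\ell=\tfrac12(N-2\ell)(N-2\ell+2)\quad(0\le \ell\le\lfloor N/2\rfloor).$$ The profile of $(x,y,z)\in X^3$ is $(r,s,t,u)$, where $r,s,t,u$ are the numbers of coordinates $i$ with $x_i=y_i=z_i$, with $x_i\ne y_i=z_i$, with $y_i\ne z_i=x_i$, and with $z_i\ne x_i=y_i$, respectively. Let $\vartheta=\varepsilon\circ\ddag:P_N\to\mathrm{End}(V)$, where $\ddag:P_N\to V^{\otimes3}$ is the linear map with $$\ddag(x^ry^sz^tw^u)=(N!\,2^N)^{1/2}\,\frac{r!\,s!\,t!\,u!}{N!\,2^N}\sum_{(a,b,c)\text{ of profile }(r,s,t,u)}a\otimes b\otimes c\qquad(r+s+t+u=N),$$ and $\varepsilon:V^{\otimes3}\to\mathrm{End}(V)$ is the linear map with $\varepsilon(a\otimes b\otimes c)=2^{N/2}e_{b,c}$ if $a=\varkappa$ and $\varepsilon(a\otimes b\otimes c)=0$ if $a\neq\varkappa$ $(a,b,c\in X)$. Then the following hold. 1. $\vartheta$ is a bijection from $P_N$ onto $T$. 2. $\phi$ is diagonalizable, and its eigenvalues are exactly the $\lambda_\ell$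 with $0\le\ell\le\lfloor N/2\rfloor$. For these $\ell$ let $\phi_\ell$ be the primitive idempotent of $\phi$ for $\lambda_\ell$, that is, the projection that is the identity on the $\lambda_\ell$-eigenspace and zero on all other eigenspaces. 3. For $0\le\ell\le\lfloor N/2\rfloor$ the subspace $R_1^\ell(\operatorname{Ker}L_1\cap P_{N-2\ell})$ is contained in $P_N$, and $$\vartheta\bigl(R_1^\ell(\operatorname{Ker}L_1\cap P_{N-2\ell})\bigr)=\phi_\ell T .$$ 4. Thus $\vartheta$ carries the orthogonal direct sum $P_N=\bigoplus_{\ell=0}^{\lfloor N/2\rfloor}R_1^\ell(\operatorname{Ker}L_1\cap P_{N-2\ell})$ to the Wedderburn decomposition $T=\bigoplus_{\ell=0}^{\lfloor N/2\rfloor}\phi_\ell T$: both are orthogonal direct sum decompositions, and every $\phi_\ell T$ is a minimal nonzero two-sided ideal of $T$. -/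

import Mathlib

open MvPolynomial TensorProduct

noncomputable section

/-! ## The polynomial algebra `P = ℂ[x, y, z, w]`, with `x, y, z, w = X 0, X 1, X 2, X 3` -/

/-- `P = ℂ[x, y, z, w]`. -/
abbrev PolyAlg : Type := MvPolynomial (Fin 4) ℂ

/-- `P_N`: the homogeneous polynomials of degree `N` (together with `0`). -/
abbrev homPoly (N : ℕ) : Submodule ℂ PolyAlg := homogeneousSubmodule (Fin 4) ℂ N

/-- The partial derivative with respect to the `a`-th variable, as a linear map. -/
def partialD (a : Fin 4) : Module.End ℂ PolyAlg := (pderiv a : Derivation ℂ PolyAlg PolyAlg).toLinearMap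

/-- Multiplication by the `a`-th variable. -/
def mulVar (a : Fin 4) : Module.End ℂ PolyAlg := LinearMap.mulLeft ℂ (X a : PolyAlg)

/-- `L₁ = D_x D_y - D_z D_w`. -/
def opL : Module.End ℂ PolyAlg := partialD 0 * partialD 1 - partialD 2 * partialD 3

/-- `R₁ = M_x M_y - M_z M_w`. -/
def opR : Module.End ℂ PolyAlg := mulVar 0 * mulVar 1 - mulVar 2 * mulVar 3

/-- The subspace `R₁^ℓ (Ker L₁ ∩ P_{N - 2ℓ})` (used for `2ℓ ≤ N` only). -/
def polySummand (N l : ℕ) : Submodule ℂ PolyAlg :=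
  (LinearMap.ker opL ⊓ homPoly (N - 2 * l)).map (opR ^ l)

/-- The factor `r! s! t! u!` of the monomial `x^r y^s z^t w^u`. -/
def monomialFactorial (m : Fin 4 →₀ ℕ) : ℕ := ∏ a, (m a).factorial

/-- The Hermitian form on `P` for which the monomials are mutually orthogonal and
`‖x^r y^s z^t w^u‖² = r! s! t! u!`. -/
def polyForm (f g : PolyAlg) : ℂ :=
  ∑ m ∈ f.support, (monomialFactorial m : ℂ) * f.coeff m * starRingEnd ℂ (g.coeff m)

/-! ## Diagonalizable maps and primitive idempotents -/

section Idempotents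

variable {W : Type*} [AddCommGroup W] [Module ℂ W]

/-- `B` is diagonalizable: the space is spanned by the eigenspaces of `B`. -/
def IsDiagonalizableMap (B : Module.End ℂ W) : Prop := ⨆ μ : ℂ, B.eigenspace μ = ⊤

open Classical in
/-- The primitive idempotent of a diagonalizable map `B` associated with the eigenvalue `θ`: it is
the identity on the `θ`-eigenspace and zero on every other eigenspace. -/
def primitiveIdempotent (B : Module.End ℂ W) (θ : ℂ) : Module.End ℂ W :=
  if h : IsCompl (B.eigenspace θ) (⨆ μ : ℂ, ⨆ _ : μ ≠ θ, B.eigenspace μ) then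
    Submodule.projection _ _ h
  else 0

theorem IsDiagonalizableMap.isCompl {B : Module.End ℂ W} (hB : IsDiagonalizableMap B) (θ : ℂ) :
    IsCompl (B.eigenspace θ) (⨆ μ : ℂ, ⨆ _ : μ ≠ θ, B.eigenspace μ) := by
  refine ⟨B.eigenspaces_iSupIndep θ, codisjoint_iff.2 (eq_top_iff.2 ?_)⟩
  rw [← hB]
  refine iSup_le fun μ => ?_
  by_cases h : μ = θ
  · subst h
    exact le_sup_left
  · exact le_sup_of_le_right (le_iSup₂_of_le μ h le_rfl)

theorem IsDiagonalizableMap.primitiveIdempotent_apply_self {B : Module.End ℂ W}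
    (hB : IsDiagonalizableMap B) {θ : ℂ} {v : W} (hv : v ∈ B.eigenspace θ) :
    primitiveIdempotent B θ v = v := by
  rw [primitiveIdempotent, dif_pos (hB.isCompl θ)]
  exact Submodule.projection_apply_left (hB.isCompl θ) ⟨v, hv⟩

theorem IsDiagonalizableMap.primitiveIdempotent_apply_of_ne {B : Module.End ℂ W}
    (hB : IsDiagonalizableMap B) {θ μ : ℂ} (hμ : μ ≠ θ) {v : W} (hv : v ∈ B.eigenspace μ) :
    primitiveIdempotent B θ v = 0 := by
  rw [primitiveIdempotent, dif_pos (hB.isCompl θ)]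
  exact (Submodule.projection_apply_eq_zero_iff (hB.isCompl θ)).2
    ((le_iSup₂_of_le (f := fun (μ : ℂ) (_ : μ ≠ θ) => B.eigenspace μ) μ hμ le_rfl) hv)

end Idempotents

/-! ## The hypercube `H(N, 2)` and its standard module -/

/-- The vertices of `H(N, 2)`: the `N`-tuples of elements of `{1, -1} = ℤˣ`. -/
abbrev Vertex (N : ℕ) : Type := Fin N → ℤˣ

/-- The graph `H(N, 2)`: vertices are adjacent when they differ in exactly one coordinate. -/
def hypercube (N : ℕ) : SimpleGraph (Vertex N) where
  Adj x y := hammingDist x y = 1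
  symm := ⟨fun x y h => by rw [hammingDist_comm]; exact h⟩
  loopless := ⟨fun x h => by simp at h⟩

instance (N : ℕ) : DecidableRel (hypercube N).Adj :=
  fun x y => inferInstanceAs (Decidable (hammingDist x y = 1))

theorem hypercube_hammingDist_le_length {N : ℕ} {x y : Vertex N} (p : (hypercube N).Walk x y) :
    hammingDist x y ≤ p.length := by
  induction p with
  | nil => simp
  | @cons a b c h p ih =>
    have h1 : hammingDist a b = 1 := h
    have h2 := hammingDist_triangle a b c
    rw [SimpleGraph.Walk.length_cons]
    omega

theorem hypercube_exists_walk {N : ℕ} (n : ℕ) : ∀ x y : Vertex N, hammingDist x y = n →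
    ∃ p : (hypercube N).Walk x y, p.length = n := by
  induction n with
  | zero =>
    intro x y h
    obtain rfl := hammingDist_eq_zero.1 h
    exact ⟨SimpleGraph.Walk.nil, rfl⟩
  | succ n ih =>
    intro x y h
    have hne : x ≠ y := by
      rintro rfl
      simp at h
    obtain ⟨i, hi⟩ := Function.ne_iff.1 hne
    have h1 : hammingDist x (Function.update x i (y i)) = 1 := by
      rw [hammingDist, Finset.card_eq_one]
      refine ⟨i, ?_⟩
      ext j
      by_cases hj : j = i
      · subst hj
        simpa using hi
      · simp [hj]
    have h2 : hammingDist (Function.update x i (y i)) y = n := by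
      have : (Finset.univ.filter fun j => Function.update x i (y i) j ≠ y j)
          = (Finset.univ.filter fun j => x j ≠ y j).erase i := by
        ext j
        by_cases hj : j = i
        · subst hj
          simp
        · simp [hj]
      rw [hammingDist, this, Finset.card_erase_of_mem (by simpa using hi)]
      rw [hammingDist] at h
      omega
    obtain ⟨p, hp⟩ := ih _ y h2
    have h3 : (hypercube N).Adj x (Function.update x i (y i)) := h1
    exact ⟨SimpleGraph.Walk.cons h3 p, by rw [SimpleGraph.Walk.length_cons, hp]⟩

/-- The path-length distance counts the coordinates in which two vertices differ. -/
theorem hypercube_dist {N : ℕ} (x y : Vertex N) : (hypercube N).dist x y = hammingDist x y := by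
  obtain ⟨p, hp⟩ := hypercube_exists_walk _ x y rfl
  refine le_antisymm (hp ▸ SimpleGraph.dist_le p) ?_
  obtain ⟨q, hq⟩ := SimpleGraph.Reachable.exists_walk_length_eq_dist ⟨p⟩
  exact hq ▸ hypercube_hammingDist_le_length q

/-- The standard module `V`: the vector space with basis the vertex set, realized as `ℂ^X` (the
vertex `x` is identified with the indicator function of `x`). -/
abbrev StdModule (N : ℕ) : Type := Vertex N → ℂ

/-- The basis of `V` consisting of the vertices. -/
abbrev vertexBasis (N : ℕ) : Module.Basis (Vertex N) ℂ (StdModule N) := Pi.basisFun ℂ (Vertex N)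

/-- The adjacency map `A`: `A x = ∑ ξ` over the neighbours `ξ` of `x`. -/
def adjMap (N : ℕ) : Module.End ℂ (StdModule N) :=
  (vertexBasis N).constr ℂ fun x => ∑ ξ ∈ (hypercube N).neighborFinset x, vertexBasis N ξ

/-- The dual adjacency map `A* = A*(ϰ)`: `A* x = (N - 2 ∂(x, ϰ)) x`. -/
def dualAdjMap (N : ℕ) (ϰ : Vertex N) : Module.End ℂ (StdModule N) :=
  (vertexBasis N).constr ℂ fun x =>
    ((N : ℂ) - 2 * ((hypercube N).dist x ϰ : ℂ)) • vertexBasis N x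

/-- The subconstituent (Terwilliger) algebra `T = T(ϰ)`, generated by `A` and `A*`. -/
def subconstituentAlgebra (N : ℕ) (ϰ : Vertex N) : Subalgebra ℂ (Module.End ℂ (StdModule N)) :=
  Algebra.adjoin ℂ {adjMap N, dualAdjMap N ϰ}

/-- `φ = (4 A² + 4 A*² - (A A* - A* A)²) / 8`. -/
def phiMap (N : ℕ) (ϰ : Vertex N) : Module.End ℂ (StdModule N) :=
  (1 / 8 : ℂ) • ((4 : ℂ) • adjMap N ^ 2 + (4 : ℂ) • dualAdjMap N ϰ ^ 2
    - (adjMap N * dualAdjMap N ϰ - dualAdjMap N ϰ * adjMap N) ^ 2)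

/-- The eigenvalue `(N - 2ℓ)(N - 2ℓ + 2) / 2`. -/
def phiEigenvalue (N l : ℕ) : ℂ := ((N : ℂ) - 2 * l) * ((N : ℂ) - 2 * l + 2) / 2

/-- `φ_ℓ`: the primitive idempotent of `φ` for the eigenvalue `(N - 2ℓ)(N - 2ℓ + 2) / 2`. -/
def phiIdempotent (N : ℕ) (ϰ : Vertex N) (l : ℕ) : Module.End ℂ (StdModule N) :=
  primitiveIdempotent (phiMap N ϰ) (phiEigenvalue N l)

/-- The subspace `φ_ℓ T = {φ_ℓ B | B ∈ T}` of `End(V)`. -/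
def wedderburnSummand (N : ℕ) (ϰ : Vertex N) (l : ℕ) :
    Submodule ℂ (Module.End ℂ (StdModule N)) :=
  (Subalgebra.toSubmodule (subconstituentAlgebra N ϰ)).map
    (LinearMap.mulLeft ℂ (phiIdempotent N ϰ l))

/-- `e_{x,y}`: the map that sends `y ↦ x` and every other vertex to `0`. -/
def elemMap {N : ℕ} (x y : Vertex N) : Module.End ℂ (StdModule N) :=
  (vertexBasis N).constr ℂ fun ψ => if ψ = y then vertexBasis N x else 0

/-- The Hermitian form on `End(V)` for which the `e_{x,y}` are orthonormal; the coefficient of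
`e_{x,y}` in `B` is the `x`-coordinate of `B y`. -/
def endForm {N : ℕ} (B C : Module.End ℂ (StdModule N)) : ℂ :=
  ∑ x : Vertex N, ∑ y : Vertex N,
    B (vertexBasis N y) x * starRingEnd ℂ (C (vertexBasis N y) x)

/-! ## The map `ϑ` -/

/-- `V ⊗ V ⊗ V`. -/
abbrev TripleModule (N : ℕ) : Type := StdModule N ⊗[ℂ] (StdModule N ⊗[ℂ] StdModule N)

/-- The basis `x ⊗ y ⊗ z` of `V ⊗ V ⊗ V`, where `x, y, z` are vertices. -/
abbrev tripleBasis (N : ℕ) :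
    Module.Basis (Vertex N × Vertex N × Vertex N) ℂ (TripleModule N) :=
  (vertexBasis N).tensorProduct ((vertexBasis N).tensorProduct (vertexBasis N))

/-- The profile `(r, s, t, u)` of `x ⊗ y ⊗ z`. -/
def profile {N : ℕ} (x y z : Vertex N) : Fin 4 → ℕ :=
  ![(Finset.univ.filter fun i => x i = y i ∧ y i = z i).card,
    (Finset.univ.filter fun i => x i ≠ y i ∧ y i = z i).card,
    (Finset.univ.filter fun i => y i ≠ z i ∧ z i = x i).card,
    (Finset.univ.filter fun i => z i ≠ x i ∧ x i = y i).card]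

/-- `B(r, s, t, u)`: the sum of the `x ⊗ y ⊗ z` that have profile `(r, s, t, u)`. -/
def profileVec (N : ℕ) (m : Fin 4 →₀ ℕ) : TripleModule N :=
  ∑ q : Vertex N × Vertex N × Vertex N with profile q.1 q.2.1 q.2.2 = m, tripleBasis N q

/-- `B̃(r, s, t, u) = (r! s! t! u! / (N! 2^N)) B(r, s, t, u)`. -/
def dualProfileVec (N : ℕ) (m : Fin 4 →₀ ℕ) : TripleModule N :=
  ((monomialFactorial m : ℂ) / ((N.factorial : ℂ) * 2 ^ N)) • profileVec N m

/-- The linear map `‡` on `P_N` that sends `x^r y^s z^t w^u ↦ (N! 2^N)^{1/2} B̃(r, s, t, u)`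
for `r + s + t + u = N`. -/
def ddagger (N : ℕ) : homPoly N →ₗ[ℂ] TripleModule N :=
  ((basisMonomials (Fin 4) ℂ).constr ℂ fun m =>
    ((Real.sqrt ((N.factorial : ℝ) * 2 ^ N) : ℝ) : ℂ) • dualProfileVec N m).domRestrict (homPoly N)

/-- The linear map `ε : V ⊗ V ⊗ V → End(V)` that sends `x ⊗ y ⊗ z` to `2^{N/2} e_{y,z}` if `x = ϰ`
and to `0` otherwise. -/
def epsMap (N : ℕ) (ϰ : Vertex N) : TripleModule N →ₗ[ℂ] Module.End ℂ (StdModule N) :=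
  (tripleBasis N).constr ℂ fun q =>
    if q.1 = ϰ then ((Real.sqrt (2 ^ N) : ℝ) : ℂ) • elemMap q.2.1 q.2.2 else 0

/-- `ϑ = ε ∘ ‡`, as a linear map from `P_N` to `End(V)`. -/
def vartheta (N : ℕ) (ϰ : Vertex N) : homPoly N →ₗ[ℂ] Module.End ℂ (StdModule N) :=
  epsMap N ϰ ∘ₗ ddagger N

end

open MvPolynomial TensorProduct

noncomputable section

/-! ## First-order operators on `P` -/

/-! The `(b, c)` entry of `ϑ(f)` is a fixed nonzero constant times `p! · coeff p f`, where `p` is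
the profile of `(ϰ, b, c)` (`theta_apply`). Flipping a coordinate of `b` or of `c` permutes the four
coordinate classes, so left and right multiplication by `A` and `A*` pull back to first-order
operators on `P` built from the `M_a D_b`.

These operators generate two copies of `sl₂`, acting on the two sides of the matrix with rows `(x,
z)` and `(w, y)`, whose determinant is `xy - zw`. By a Capelli identity the expression defining `φ`
gives the same operator on both sides, `(E² + 2E - 4 R₁L₁) / 2` with `E` the Euler operator
(`casimir_left`, `casimir_right`). Hence `φ` is central in `T`. Since `[L₁, R₁] = E + 2`, this
operator is the scalar `λ_ℓ` on `R₁^ℓ (Ker L₁ ∩ P_{N-2ℓ})`, and `P_N` is the direct sum of these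
spaces. So `ϑ` carries the harmonic decomposition to the spectral decomposition of `T` under `φ`.

Injectivity holds because every exponent of degree `N` is a profile. The image is `T` because a
multiple of `(x + y)^N` maps to the identity, the image is stable under `A` and `A*`, and `(x +
y)^N` generates `P_N` under the left operators alone (`homPoly_le_of_stable`).

For minimality, any nonzero bimodule inside `φ_ℓ T` contains a vector killed by both raising
operators, and up to scalars the only one is the image of `R₁^ℓ x^{N-2ℓ}`. The orthogonal complement
of the bimodule is again a bimodule, as `A` and `A*` are self-adjoint. If nonzero, it would contain
the same vector, which is impossible. -/

theorem pderiv_pderiv_comm (a b : Fin 4) (f : PolyAlg) :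
    pderiv a (pderiv b f) = pderiv b (pderiv a f) := by
  ext m
  simp only [coeff_pderiv]
  rw [add_right_comm m]
  rcases eq_or_ne a b with rfl | h
  · rfl
  · simp [h, h.symm]
    ring

/-- The operator `M_a D_b`. -/
def xD (a b : Fin 4) : Module.End ℂ PolyAlg := mulVar a * partialD b

@[simp] theorem xD_apply (a b : Fin 4) (f : PolyAlg) : xD a b f = X a * pderiv b f := rfl

theorem opL_apply (f : PolyAlg) : opL f = pderiv 0 (pderiv 1 f) - pderiv 2 (pderiv 3 f) := rfl

theorem opR_apply (f : PolyAlg) : opR f = (X 0 * X 1 - X 2 * X 3) * f := by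
  change X 0 * (X 1 * f) - X 2 * (X 3 * f) = _
  ring

/-- The operator on `P` that corresponds to `B ↦ A B`. -/
def leftAdj : Module.End ℂ PolyAlg := xD 0 2 + xD 1 3 + xD 2 0 + xD 3 1

/-- The operator on `P` that corresponds to `B ↦ B A`. -/
def rightAdj : Module.End ℂ PolyAlg := xD 0 3 + xD 1 2 + xD 2 1 + xD 3 0

/-- The operator on `P` that corresponds to `B ↦ A* B`. -/
def leftDual : Module.End ℂ PolyAlg := xD 0 0 - xD 1 1 - xD 2 2 + xD 3 3

/-- The operator on `P` that corresponds to `B ↦ B A*`. -/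
def rightDual : Module.End ℂ PolyAlg := xD 0 0 - xD 1 1 + xD 2 2 - xD 3 3

/-- The Euler operator. -/
def eulerOp : Module.End ℂ PolyAlg := ∑ a, xD a a

theorem eulerOp_apply_of_mem {n : ℕ} {f : PolyAlg} (hf : f ∈ homPoly n) :
    eulerOp f = (n : ℂ) • f := by
  have := ((mem_homogeneousSubmodule n f).1 hf).sum_X_mul_pderiv
  simp only [eulerOp, LinearMap.sum_apply, xD_apply, this, Nat.cast_smul_eq_nsmul]

/-- Half the commutator of `leftAdj` and `leftDual`. -/
def leftAdjComm : Module.End ℂ PolyAlg := xD 2 0 + xD 1 3 - xD 0 2 - xD 3 1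

/-- Half the commutator of `rightAdj` and `rightDual`. -/
def rightAdjComm : Module.End ℂ PolyAlg := xD 3 0 + xD 1 2 - xD 0 3 - xD 2 1

theorem leftAdj_leftDual_comm :
    leftAdj * leftDual - leftDual * leftAdj = (2 : ℂ) • leftAdjComm := by
  refine LinearMap.ext fun f => ?_
  simp only [leftAdj, leftDual, leftAdjComm, Module.End.mul_apply, two_smul,
    LinearMap.add_apply, LinearMap.sub_apply, xD_apply, map_add,
    map_sub, pderiv_mul, pderiv_X, Pi.single_apply]
  simp
  -- Mixed derivatives are put in one order so that `ring` sees equal ones as the same atom.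
  rw [pderiv_pderiv_comm 1 0, pderiv_pderiv_comm 2 0, pderiv_pderiv_comm 3 0,
    pderiv_pderiv_comm 2 1, pderiv_pderiv_comm 3 1, pderiv_pderiv_comm 3 2]
  ring

theorem rightAdj_rightDual_comm :
    rightAdj * rightDual - rightDual * rightAdj = (2 : ℂ) • rightAdjComm := by
  refine LinearMap.ext fun f => ?_
  simp only [rightAdj, rightDual, rightAdjComm, Module.End.mul_apply, two_smul,
    LinearMap.add_apply, LinearMap.sub_apply, xD_apply, map_add,
    map_sub, pderiv_mul, pderiv_X, Pi.single_apply]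
  simp
  rw [pderiv_pderiv_comm 1 0, pderiv_pderiv_comm 2 0, pderiv_pderiv_comm 3 0,
    pderiv_pderiv_comm 2 1, pderiv_pderiv_comm 3 1, pderiv_pderiv_comm 3 2]
  ring

/-- The polynomial in `B, C` that defines `φ`. -/
def casimir {W : Type*} [AddCommGroup W] [Module ℂ W] (B C : Module.End ℂ W) : Module.End ℂ W :=
  (1 / 8 : ℂ) • ((4 : ℂ) • B ^ 2 + (4 : ℂ) • C ^ 2 - (B * C - C * B) ^ 2)

theorem casimir_eq {W : Type*} [AddCommGroup W] [Module ℂ W] {B C K : Module.End ℂ W}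
    (h : B * C - C * B = (2 : ℂ) • K) :
    casimir B C = (1 / 2 : ℂ) • (B * B + C * C - K * K) := by
  rw [casimir, h, smul_pow, ← smul_add, show (2 : ℂ) ^ 2 = 4 by norm_num, ← smul_sub, smul_smul]
  norm_num [pow_two]

/-- The right hand side of the Capelli identity. -/
def capelliOp : Module.End ℂ PolyAlg :=
  (1 / 2 : ℂ) • (eulerOp * eulerOp + (2 : ℂ) • eulerOp - (4 : ℂ) • (opR * opL))

/-- Capelli's identity: the quadratic Casimir of the left `sl₂` is expressed through the Euler
operator and the product of `xy - zw` with its dual operator `L₁`. The right action has the same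
Casimir, which is what makes `φ` central. -/
theorem casimir_left : casimir leftAdj leftDual = capelliOp := by
  rw [casimir_eq leftAdj_leftDual_comm, capelliOp]
  congr 1
  refine LinearMap.ext fun f => ?_
  simp only [leftAdj, leftDual, leftAdjComm, eulerOp, opR_apply, opL_apply, Fin.sum_univ_four,
    Module.End.mul_apply, two_smul, show (4 : ℂ) = 2 + 2 by norm_num,
    add_smul, LinearMap.add_apply, LinearMap.sub_apply, xD_apply, map_add,
    map_sub, pderiv_mul, pderiv_X, Pi.single_apply]
  simp
  rw [pderiv_pderiv_comm 1 0, pderiv_pderiv_comm 2 0, pderiv_pderiv_comm 3 0,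
    pderiv_pderiv_comm 2 1, pderiv_pderiv_comm 3 1, pderiv_pderiv_comm 3 2]
  ring

theorem casimir_right : casimir rightAdj rightDual = capelliOp := by
  rw [casimir_eq rightAdj_rightDual_comm, capelliOp]
  congr 1
  refine LinearMap.ext fun f => ?_
  simp only [rightAdj, rightDual, rightAdjComm, eulerOp, opR_apply, opL_apply, Fin.sum_univ_four,
    Module.End.mul_apply, two_smul, show (4 : ℂ) = 2 + 2 by norm_num,
    add_smul, LinearMap.add_apply, LinearMap.sub_apply, xD_apply, map_add,
    map_sub, pderiv_mul, pderiv_X, Pi.single_apply]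
  simp
  rw [pderiv_pderiv_comm 1 0, pderiv_pderiv_comm 2 0, pderiv_pderiv_comm 3 0,
    pderiv_pderiv_comm 2 1, pderiv_pderiv_comm 3 1, pderiv_pderiv_comm 3 2]
  ring

/-- The relation `[L₁, R₁] = E + 2`, the source of all scalars in the harmonic decomposition. -/
theorem opL_opR (f : PolyAlg) :
    opL (opR f) = opR (opL f) + eulerOp f + (2 : ℂ) • f := by
  simp only [eulerOp, opR_apply, opL_apply, Fin.sum_univ_four, two_smul, LinearMap.add_apply,
    xD_apply, map_add, map_sub, pderiv_mul, pderiv_X, Pi.single_apply]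
  simp
  ring

/-! ## The harmonic decomposition -/

theorem pderiv_of_mem_homPoly_zero (a : Fin 4) {f : PolyAlg} (hf : f ∈ homPoly 0) :
    pderiv a f = 0 := by
  rw [totalDegree_eq_zero_iff_eq_C.1 (Nat.le_zero.1
    ((mem_homogeneousSubmodule _ _).1 hf).totalDegree_le), pderiv_C]

theorem xD_mem {n : ℕ} (a b : Fin 4) {f : PolyAlg} (hf : f ∈ homPoly n) :
    xD a b f ∈ homPoly n := by
  rw [xD_apply]
  -- Differentiation lowers the degree by truncated subtraction, so degree `0` is treated apart.
  rcases n with _ | n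
  · rw [pderiv_of_mem_homPoly_zero b hf, mul_zero]
    exact zero_mem _
  · have := (isHomogeneous_X ℂ a).mul (((mem_homogeneousSubmodule _ _).1 hf).pderiv (i := b))
    simpa [add_comm] using this

theorem opR_mem {n : ℕ} {f : PolyAlg} (hf : f ∈ homPoly n) : opR f ∈ homPoly (n + 2) := by
  rw [mem_homogeneousSubmodule] at hf ⊢
  rw [opR_apply, add_comm]
  exact (((isHomogeneous_X ℂ _).mul (isHomogeneous_X ℂ _)).sub
    ((isHomogeneous_X ℂ _).mul (isHomogeneous_X ℂ _))).mul hf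

theorem opR_pow_mem {n : ℕ} (l : ℕ) {f : PolyAlg} (hf : f ∈ homPoly n) :
    (opR ^ l) f ∈ homPoly (n + 2 * l) := by
  induction l with
  | zero => simpa using hf
  | succ l ih =>
    rw [pow_succ', Module.End.mul_apply]
    exact opR_mem ih

theorem opL_mem {n : ℕ} {f : PolyAlg} (hf : f ∈ homPoly (n + 2)) : opL f ∈ homPoly n := by
  rw [mem_homogeneousSubmodule] at hf ⊢
  exact (hf.pderiv.pderiv).sub (hf.pderiv.pderiv)

theorem opR_injective : Function.Injective opR := by
  have h : (X 0 * X 1 - X 2 * X 3 : PolyAlg) ≠ 0 := by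
    intro h
    have := congr_arg (MvPolynomial.eval ![1, 1, 0, 0]) h
    simp at this
  intro f g hfg
  rw [opR_apply, opR_apply] at hfg
  exact mul_left_cancel₀ h hfg

theorem opR_pow_injective (l : ℕ) : Function.Injective (opR ^ l : Module.End ℂ PolyAlg) := by
  rw [Module.End.coe_pow]
  exact opR_injective.iterate l

/-- Moving `L₁` through each factor `R₁` contributes `E + 2`; the scalar is the sum of `n + 2i + 2`
over `0 ≤ i ≤ l`. -/
theorem opL_opR_pow {n : ℕ} (l : ℕ) {h : PolyAlg} (hL : opL h = 0) (hh : h ∈ homPoly n) :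
    opL ((opR ^ (l + 1)) h) = ((l + 1 : ℂ) * (l + n + 2)) • (opR ^ l) h := by
  induction l with
  | zero =>
    rw [zero_add, pow_one, opL_opR, hL, eulerOp_apply_of_mem hh]
    simp [add_smul]
  | succ l ih =>
    rw [pow_succ', Module.End.mul_apply, opL_opR, ih, map_smul,
      eulerOp_apply_of_mem (opR_pow_mem _ hh), ← Module.End.mul_apply opR, ← pow_succ',
      ← add_smul, ← add_smul]
    congr 1
    push_cast
    ring

theorem polySummand_le {N l : ℕ} (hl : l ≤ N / 2) : polySummand N l ≤ homPoly N := by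
  rintro _ ⟨h, hh, rfl⟩
  have := opR_pow_mem l hh.2
  rwa [show N - 2 * l + 2 * l = N by omega] at this

theorem capelliOp_apply_of_mem {N l : ℕ} (hl : l ≤ N / 2) {f : PolyAlg}
    (hf : f ∈ polySummand N l) : capelliOp f = phiEigenvalue N l • f := by
  have hN := eulerOp_apply_of_mem (polySummand_le hl hf)
  obtain ⟨h, ⟨hL, hh⟩, rfl⟩ := hf
  obtain ⟨n, rfl⟩ : ∃ n, N = n + 2 * l := ⟨N - 2 * l, by omega⟩
  rw [Nat.add_sub_cancel] at hh
  simp only [capelliOp, LinearMap.smul_apply, LinearMap.sub_apply, LinearMap.add_apply,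
    Module.End.mul_apply, hN, map_smul, phiEigenvalue]
  have hRL : opR (opL ((opR ^ l) h)) = ((l : ℂ) * (l + n + 1)) • (opR ^ l) h := by
    rcases l with _ | l
    · simp [LinearMap.mem_ker.1 hL]
    · rw [opL_opR_pow l hL hh, map_smul, ← Module.End.mul_apply opR, ← pow_succ']
      congr 1
      push_cast
      ring
  rw [hRL]
  simp only [smul_smul, ← add_smul, ← sub_smul]
  congr 1
  push_cast
  ring

theorem opL_eq_zero_of_mem {n : ℕ} (hn : n < 2) {f : PolyAlg} (hf : f ∈ homPoly n) :
    opL f = 0 := by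
  have h (a b : Fin 4) : pderiv a (pderiv b f) = 0 := by
    rcases n with _ | n
    · rw [pderiv_of_mem_homPoly_zero b hf, map_zero]
    · obtain rfl : n = 0 := by omega
      exact pderiv_of_mem_homPoly_zero a
        (((mem_homogeneousSubmodule _ _).1 hf).pderiv (i := b))
  rw [opL_apply, h, h, sub_zero]

theorem opL_opR_of_mem {N l : ℕ} {f : PolyAlg} (hf : f ∈ polySummand N l) :
    opL (opR f) = ((l + 1 : ℂ) * ((N - 2 * l : ℕ) + l + 2)) • f := by
  obtain ⟨h, ⟨hL, hh⟩, rfl⟩ := hf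
  rw [← Module.End.mul_apply opR, ← pow_succ', opL_opR_pow l hL hh]
  congr 2
  ring

theorem opR_mem_polySummand {N l : ℕ} {f : PolyAlg} (hf : f ∈ polySummand N l) :
    opR f ∈ polySummand (N + 2) (l + 1) := by
  obtain ⟨h, hh, rfl⟩ := hf
  refine ⟨h, ?_, ?_⟩
  · rwa [show N + 2 - 2 * (l + 1) = N - 2 * l by omega]
  · rw [pow_succ', Module.End.mul_apply]

/-- Decompose `L₁ f` by induction. On each summand `L₁ R₁` is a nonzero scalar, so every component
lifts through `L₁`; subtracting the lifts from `f` leaves a harmonic remainder. -/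
theorem exists_harmonic_decomposition {N : ℕ} {f : PolyAlg} (hf : f ∈ homPoly N) :
    ∃ h : ℕ → PolyAlg, (∀ l ≤ N / 2, h l ∈ polySummand N l) ∧
      f = ∑ l ∈ Finset.range (N / 2 + 1), h l := by
  induction N using Nat.strong_induction_on generalizing f with
  | _ N ih =>
  rcases lt_or_ge N 2 with hN | hN
  · refine ⟨fun _ => f, fun l hl => ?_, ?_⟩
    · obtain rfl : l = 0 := by omega
      exact ⟨f, ⟨opL_eq_zero_of_mem hN hf, hf⟩, rfl⟩
    · rw [show N / 2 = 0 by omega]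
      simp
  · obtain ⟨n, rfl⟩ : ∃ n, N = n + 2 := ⟨N - 2, by omega⟩
    obtain ⟨g, hg, hs⟩ := ih n (by omega) (opL_mem hf)
    have hn : (n + 2) / 2 = n / 2 + 1 := by omega
    -- The scalar by which `L₁ R₁` acts on the `l`-th summand of `P_n`.
    let c (l : ℕ) : ℂ := (l + 1 : ℂ) * ((n - 2 * l : ℕ) + l + 2)
    have hc (l : ℕ) : c l ≠ 0 := by
      have : (((l + 1) * (n - 2 * l + l + 2) : ℕ) : ℂ) ≠ 0 := by
        exact Nat.cast_ne_zero.2 (by positivity)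
      simpa [c] using this
    let k (l : ℕ) : PolyAlg := (c l)⁻¹ • opR (g l)
    have hk (l : ℕ) (hl : l ≤ n / 2) : opL (k l) = g l := by
      rw [map_smul, opL_opR_of_mem (hg l hl), smul_smul, inv_mul_cancel₀ (hc l), one_smul]
    have hkm (l : ℕ) (hl : l ≤ n / 2) : k l ∈ polySummand (n + 2) (l + 1) :=
      Submodule.smul_mem _ _ (opR_mem_polySummand (hg l hl))
    -- Multiplication by `xy - zw` shifts the index: the harmonic remainder takes index `0` and `k
    -- l` takes index `l + 1`.
    refine ⟨fun l => Nat.casesOn l (f - ∑ l ∈ Finset.range (n / 2 + 1), k l) k, ?_, ?_⟩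
    · rintro (_ | l) hl
      · refine ⟨_, ⟨?_, ?_⟩, rfl⟩
        · change opL (f - _) = 0
          rw [map_sub, map_sum, hs, sub_eq_zero]
          exact Finset.sum_congr rfl fun l hl =>
            (hk l (by have := Finset.mem_range.1 hl; omega)).symm
        · refine Submodule.sub_mem _ hf (Submodule.sum_mem _ fun l hl => ?_)
          have := Finset.mem_range.1 hl
          exact polySummand_le (by omega) (hkm l (by omega))
      · exact hkm l (by omega)
    · rw [hn, Finset.sum_range_succ']
      simp

theorem phiEigenvalue_injOn {N l k : ℕ} (hl : l ≤ N / 2) (hk : k ≤ N / 2)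
    (h : phiEigenvalue N l = phiEigenvalue N k) : l = k := by
  obtain ⟨a, ha⟩ : ∃ a, N = a + 2 * l := ⟨N - 2 * l, by omega⟩
  obtain ⟨b, hb⟩ : ∃ b, N = b + 2 * k := ⟨N - 2 * k, by omega⟩
  have ha' : (N : ℂ) - 2 * l = a := by rw [ha]; push_cast; ring
  have hb' : (N : ℂ) - 2 * k = b := by rw [hb]; push_cast; ring
  rw [phiEigenvalue, phiEigenvalue, ha', hb', div_left_inj' two_ne_zero] at h
  have h' : a * (a + 2) = b * (b + 2) := by exact_mod_cast h
  have : a = b := by nlinarith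
  omega

theorem iSupIndep_polySummand {N : ℕ} :
    iSupIndep fun l : Fin (N / 2 + 1) => polySummand N l := by
  have h := (Module.End.eigenspaces_iSupIndep capelliOp).comp
    (f := fun l : Fin (N / 2 + 1) => phiEigenvalue N l) fun l k hlk =>
      Fin.ext (phiEigenvalue_injOn (by omega) (by omega) hlk)
  exact h.mono fun l f hf =>
    Module.End.mem_eigenspace_iff.2 (capelliOp_apply_of_mem (by omega) hf)

theorem isInternal_submoduleOf {R M ι : Type*} [Ring R] [AddCommGroup M] [Module R M]
    [Fintype ι] [DecidableEq ι] {S : ι → Submodule R M} {W : Submodule R M} (hle : ∀ i, S i ≤ W)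
    (hS : iSupIndep S) (hsum : ∀ w ∈ W, ∃ v : ι → M, (∀ i, v i ∈ S i) ∧ w = ∑ i, v i) :
    DirectSum.IsInternal fun i => (S i).submoduleOf W := by
  rw [DirectSum.isInternal_submodule_iff_iSupIndep_and_iSup_eq_top]
  constructor
  · rw [iSupIndep_iff_finsetSum_eq_zero_imp_eq_zero] at hS ⊢
    intro s v hv h0 i hi
    exact Subtype.ext (hS s (fun i => v i) (fun i hi => hv i hi)
      (by simpa using congr_arg W.subtype h0) i hi)
  · refine eq_top_iff.2 fun w _ => ?_
    obtain ⟨v, hv, hw⟩ := hsum w w.2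
    have : w = ∑ i, (⟨v i, hle i (hv i)⟩ : W) := by
      ext
      simpa using hw
    rw [this]
    exact Submodule.sum_mem _ fun i _ => Submodule.mem_iSup_of_mem i (hv i)

/-! ## The Hermitian form on `P` -/

theorem polyForm_eq_sum {f : PolyAlg} (g : PolyAlg) {s : Finset (Fin 4 →₀ ℕ)}
    (hs : f.support ⊆ s) :
    polyForm f g = ∑ m ∈ s, (monomialFactorial m : ℂ) * f.coeff m * starRingEnd ℂ (g.coeff m) :=
  Finset.sum_subset hs fun m _ hm => by simp [notMem_support_iff.1 hm]

theorem polyForm_conj (f g : PolyAlg) : polyForm g f = starRingEnd ℂ (polyForm f g) := by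
  classical
  rw [polyForm_eq_sum g (Finset.subset_union_left (s₂ := g.support)),
    polyForm_eq_sum f (Finset.subset_union_right (s₁ := f.support)), map_sum]
  refine Finset.sum_congr rfl fun m _ => ?_
  simp
  ring

theorem polyForm_sub_left (f₁ f₂ g : PolyAlg) :
    polyForm (f₁ - f₂) g = polyForm f₁ g - polyForm f₂ g := by
  classical
  rw [polyForm_eq_sum g (support_sub _ f₁ f₂),
    polyForm_eq_sum g (Finset.subset_union_left (s₂ := f₂.support)),
    polyForm_eq_sum g (Finset.subset_union_right (s₁ := f₁.support)), ← Finset.sum_sub_distrib]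
  refine Finset.sum_congr rfl fun m _ => ?_
  rw [coeff_sub]
  ring

theorem polyForm_sub_right (f g₁ g₂ : PolyAlg) :
    polyForm f (g₁ - g₂) = polyForm f g₁ - polyForm f g₂ := by
  rw [polyForm_conj _ f, polyForm_sub_left, map_sub, ← polyForm_conj, ← polyForm_conj]

theorem monomialFactorial_add_single (m : Fin 4 →₀ ℕ) (a : Fin 4) :
    monomialFactorial (m + Finsupp.single a 1) = (m a + 1) * monomialFactorial m := by
  rw [monomialFactorial, monomialFactorial, ← Finset.mul_prod_erase _ _ (Finset.mem_univ a),
    ← Finset.mul_prod_erase _ (fun b => (m b).factorial) (Finset.mem_univ a), ← mul_assoc]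
  congr 1
  · simp [Nat.factorial_succ]
  · refine Finset.prod_congr rfl fun b hb => ?_
    simp [(Finset.ne_of_mem_erase hb).symm]

/-- The factorial weights make `M_a` and `D_a` adjoint, since raising `m a` by one multiplies the
weight by `m a + 1`. Hence `R₁` and `L₁` are adjoint. -/
theorem polyForm_X_mul (a : Fin 4) (f g : PolyAlg) :
    polyForm (X a * f) g = polyForm f (pderiv a g) := by
  rw [polyForm, support_X_mul, Finset.sum_map, polyForm]
  refine Finset.sum_congr rfl fun m _ => ?_
  rw [addLeftEmbedding_apply, coeff_X_mul, add_comm, monomialFactorial_add_single, coeff_pderiv]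
  simp
  ring

theorem polyForm_opR (f g : PolyAlg) : polyForm (opR f) g = polyForm f (opL g) := by
  rw [opR_apply, sub_mul, mul_assoc, mul_assoc, polyForm_sub_left, polyForm_X_mul, polyForm_X_mul,
    polyForm_X_mul, polyForm_X_mul, ← polyForm_sub_right, opL_apply, pderiv_pderiv_comm 0,
    pderiv_pderiv_comm 2]

theorem polyForm_opR_pow (k : ℕ) (f g : PolyAlg) :
    polyForm ((opR ^ k) f) g = polyForm f ((opL ^ k) g) := by
  induction k generalizing g with
  | zero => simp
  | succ k ih => rw [pow_succ', Module.End.mul_apply, polyForm_opR, ih, pow_succ,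
      Module.End.mul_apply]

theorem opL_pow_opR_pow {n l k : ℕ} (hlk : l < k) {h : PolyAlg} (hL : opL h = 0)
    (hh : h ∈ homPoly n) : (opL ^ k) ((opR ^ l) h) = 0 := by
  induction l generalizing k with
  | zero =>
    obtain ⟨k, rfl⟩ : ∃ j, k = j + 1 := ⟨k - 1, by omega⟩
    rw [pow_zero, Module.End.one_apply, pow_succ, Module.End.mul_apply, hL, map_zero]
  | succ l ih =>
    obtain ⟨k, rfl⟩ : ∃ j, k = j + 1 := ⟨k - 1, by omega⟩
    rw [pow_succ opL, Module.End.mul_apply, opL_opR_pow l hL hh, map_smul, ih (by omega),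
      smul_zero]

/-- By adjointness `R₁^k` on the left becomes `L₁^k` on the right, which annihilates `R₁^l h` for
harmonic `h` because `l < k`. -/
theorem polyForm_eq_zero_of_lt {N l k : ℕ} (hlk : l < k) {f g : PolyAlg}
    (hf : f ∈ polySummand N k) (hg : g ∈ polySummand N l) : polyForm f g = 0 := by
  obtain ⟨f, -, rfl⟩ := hf
  obtain ⟨g, ⟨hL, hg⟩, rfl⟩ := hg
  rw [polyForm_opR_pow, opL_pow_opR_pow hlk hL hg]
  simp [polyForm]

theorem polyForm_eq_zero_of_ne {N l k : ℕ} (hlk : l ≠ k) {f g : PolyAlg}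
    (hf : f ∈ polySummand N l) (hg : g ∈ polySummand N k) : polyForm f g = 0 := by
  rcases hlk.lt_or_gt with h | h
  · rw [polyForm_conj, polyForm_eq_zero_of_lt h hg hf, map_zero]
  · exact polyForm_eq_zero_of_lt h hf hg

theorem isInternal_polySummand (N : ℕ) : DirectSum.IsInternal
    fun l : Fin (N / 2 + 1) => (polySummand N l).submoduleOf (homPoly N) := by
  refine isInternal_submoduleOf (fun l => polySummand_le (by omega)) iSupIndep_polySummand
    fun f hf => ?_
  obtain ⟨h, hh, hs⟩ := exists_harmonic_decomposition hf
  exact ⟨fun l => h l, fun l => hh l (by omega), by rw [hs, Finset.sum_range]⟩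

/-! ## Highest weight vectors -/

theorem eq_smul_X_pow_of_pderiv_eq_zero {n : ℕ} {h : PolyAlg} (hh : h ∈ homPoly n)
    (h0 : ∀ b ≠ 0, pderiv b h = 0) : ∃ c : ℂ, h = c • X 0 ^ n := by
  refine ⟨coeff (Finsupp.single 0 n) h, ?_⟩
  ext m
  rw [coeff_smul, coeff_X_pow]
  split_ifs with hm
  · rw [← hm, smul_eq_mul, mul_one]
  · rw [smul_zero]
    by_contra hne
    have hdeg := hh hne
    have hb : ∃ b ≠ 0, m b ≠ 0 := by
      by_contra! hb
      apply hm
      have hs : m = Finsupp.single 0 (m 0) := by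
        ext b
        by_cases h : b = 0
        · simp [h]
        · simp [hb b h, Ne.symm h]
      rw [hs] at hdeg ⊢
      rw [Finsupp.weight_single] at hdeg
      rw [show m 0 = n by simpa using hdeg]
    obtain ⟨b, hb, hmb⟩ := hb
    have h1 : m - Finsupp.single b 1 + Finsupp.single b 1 = m :=
      tsub_add_cancel_of_le (by
        rw [Finsupp.single_le_iff]
        omega)
    have h2 := coeff_pderiv (i := b) h (m - Finsupp.single b 1)
    rw [h0 b hb, h1, coeff_zero] at h2
    rcases mul_eq_zero.1 h2.symm with h3 | h3
    · exact hne h3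
    · exact Nat.cast_add_one_ne_zero _ h3

/-- The raising operator that corresponds to left multiplication. -/
def leftRaise : Module.End ℂ PolyAlg := xD 3 1 + xD 0 2

/-- The raising operator that corresponds to right multiplication. -/
def rightRaise : Module.End ℂ PolyAlg := xD 2 1 + xD 0 3

/-- The raising operator is a derivation that kills `xy - zw`. -/
theorem leftRaise_opR (f : PolyAlg) : leftRaise (opR f) = opR (leftRaise f) := by
  simp only [leftRaise, opR_apply, LinearMap.add_apply, xD_apply, map_sub, pderiv_mul, pderiv_X,
    Pi.single_apply]
  simp
  ring

theorem rightRaise_opR (f : PolyAlg) : rightRaise (opR f) = opR (rightRaise f) := by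
  simp only [rightRaise, opR_apply, LinearMap.add_apply, xD_apply, map_sub, pderiv_mul, pderiv_X,
    Pi.single_apply]
  simp
  ring

theorem map_opR_pow {D : Module.End ℂ PolyAlg} (hD : ∀ f, D (opR f) = opR (D f)) (l : ℕ)
    (f : PolyAlg) : D ((opR ^ l) f) = (opR ^ l) (D f) := by
  have h : Commute D opR := LinearMap.ext hD
  exact LinearMap.congr_fun (h.pow_right l).eq f

/-- Applying `D_y` repeatedly gives `(n + 1 - k) x D_y^k g = (xy - zw) D_y^(k+1) g`. Since
`D_y^(n+1) g = 0` by degree, vanishing descends from `k = n + 1` to `k = 0`. -/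
theorem eq_zero_of_pderiv_relation {n : ℕ} {g : PolyAlg} (hg : g ∈ homPoly n)
    (h : ((n + 1 : ℕ) : PolyAlg) * (X 0 * g) = (X 0 * X 1 - X 2 * X 3) * pderiv 1 g) : g = 0 := by
  have hrel (k : ℕ) : ∀ j : ℕ, j + k = n + 1 → (j : PolyAlg) * (X 0 * (pderiv 1)^[k] g) =
      (X 0 * X 1 - X 2 * X 3) * (pderiv 1)^[k + 1] g := by
    induction k with
    | zero =>
      rintro j rfl
      exact h
    | succ k ih =>
      intro j hj
      have h1 := congr_arg (pderiv 1) (ih (j + 1) (by omega))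
      rw [pderiv_mul, pderiv_mul, pderiv_mul, map_sub, pderiv_mul, pderiv_mul,
        Derivation.map_natCast, pderiv_X_self, pderiv_X_of_ne (by decide), pderiv_X_of_ne (by decide),
        pderiv_X_of_ne (by decide), ← Function.iterate_succ_apply' (pderiv 1),
        ← Function.iterate_succ_apply' (pderiv 1)] at h1
      push_cast at h1
      linear_combination h1
  have hmem (k j : ℕ) (hk : n = j + k) : (pderiv 1)^[k] g ∈ homPoly j := by
    induction k generalizing j with
    | zero => rw [hk] at hg; exact hg
    | succ k ih =>
      rw [Function.iterate_succ_apply']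
      exact ((mem_homogeneousSubmodule _ _).1 (ih (j + 1) (by omega))).pderiv
  have hz (j : ℕ) : ∀ k, j + k = n + 1 → (pderiv 1)^[k] g = 0 := by
    induction j with
    | zero =>
      intro k hk
      obtain rfl : k = n + 1 := by omega
      rw [Function.iterate_succ_apply']
      exact pderiv_of_mem_homPoly_zero 1 (hmem n 0 (by omega))
    | succ j ih =>
      intro k hk
      have h1 := hrel k (j + 1) hk
      rw [ih (k + 1) (by omega), mul_zero] at h1
      exact (mul_eq_zero.1 ((mul_eq_zero.1 h1).resolve_left
        (Nat.cast_ne_zero.2 j.succ_ne_zero))).resolve_left (X_ne_zero 0)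
  exact hz (n + 1) 0 rfl

/-- Harmonicity and the right raising equation force `D_y h = 0`; the two raising equations then
reduce to `x D_z h = 0` and `x D_w h = 0`, so `h` involves only `x`. -/
theorem eq_smul_X_pow_of_highestWeight {n : ℕ} {h : PolyAlg} (hh : h ∈ homPoly n)
    (hL : opL h = 0) (h1 : leftRaise h = 0) (h2 : rightRaise h = 0) :
    ∃ c : ℂ, h = c • X 0 ^ n := by
  simp only [leftRaise, rightRaise, LinearMap.add_apply, xD_apply] at h1 h2
  have hg : pderiv 1 h = 0 := by
    rcases n with _ | n
    · exact pderiv_of_mem_homPoly_zero 1 hh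
    have hgm : pderiv 1 h ∈ homPoly n :=
      ((mem_homogeneousSubmodule _ _).1 hh).pderiv
    refine eq_zero_of_pderiv_relation hgm ?_
    have e0 := ((mem_homogeneousSubmodule _ _).1 hgm).sum_X_mul_pderiv
    have e2 := congr_arg (pderiv 1) h2
    have e3 := congr_arg (pderiv 2) h2
    rw [opL_apply] at hL
    rw [nsmul_eq_mul, Fin.sum_univ_four] at e0
    simp only [pderiv_mul, map_add, pderiv_X, Pi.single_apply] at e2 e3
    simp at e2 e3
    rw [pderiv_pderiv_comm 1 3] at e2
    push_cast
    -- With `g = D_y h`, this combination cancels `D_x g`, `D_z g`, `D_w g` and `D_z D_w h`, leaving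
    -- only `g` and `D_y g`.
    linear_combination (-X 0) * e0 + X 0 * X 0 * hL + X 3 * e2 + X 0 * e3
  have hz {b : Fin 4} (hb : X 0 * pderiv b h = 0) : pderiv b h = 0 :=
    (mul_eq_zero.1 hb).resolve_left (X_ne_zero 0)
  rw [hg, mul_zero, zero_add] at h1 h2
  refine eq_smul_X_pow_of_pderiv_eq_zero hh fun b hb => ?_
  fin_cases b
  · exact absurd rfl hb
  · exact hg
  · exact hz h1
  · exact hz h2

theorem exists_mem_support_of_mem_support_xD {a b : Fin 4} {f : PolyAlg} {m : Fin 4 →₀ ℕ}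
    (hm : m ∈ (xD a b f).support) :
    ∃ k ∈ f.support, m + Finsupp.single b 1 = k + Finsupp.single a 1 := by
  classical
  rw [mem_support_iff, xD_apply, coeff_X_mul'] at hm
  split_ifs at hm with ha
  · rw [coeff_pderiv] at hm
    refine ⟨_, mem_support_iff.2 (left_ne_zero_of_mul hm), ?_⟩
    rw [add_right_comm, tsub_add_cancel_of_le]
    rw [Finsupp.single_le_iff]
    exact Nat.one_le_iff_ne_zero.2 (Finsupp.mem_support_iff.1 ha)
  · exact absurd rfl hm

/-- The weight of a monomial with respect to which `leftRaise` and `rightRaise` have degree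
`-1`. -/
def monomialWeight (m : Fin 4 →₀ ℕ) : ℕ := 2 * m 1 + m 2 + m 3

/-- Each term of a raising operator trades a `y` for `z` or `w`, or one of `z`, `w` for `x`,
lowering the weight by one. This makes the search for a highest weight vector terminate. -/
theorem sup_monomialWeight_lt {D : Module.End ℂ PolyAlg}
    (hD : D = leftRaise ∨ D = rightRaise) {f : PolyAlg} (hf : D f ≠ 0) :
    (D f).support.sup monomialWeight < f.support.sup monomialWeight := by
  classical
  obtain ⟨m, hm, hms⟩ := Finset.exists_mem_eq_sup _ (support_nonempty.2 hf) monomialWeight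
  rw [hms]
  have key : ∃ k ∈ f.support, monomialWeight m < monomialWeight k := by
    have h4 (k : Fin 4 →₀ ℕ) (a b : Fin 4) (h : m + Finsupp.single b 1 = k + Finsupp.single a 1)
        (c : Fin 4) : m c + (Pi.single b 1 : Fin 4 → ℕ) c = k c + (Pi.single a 1 : Fin 4 → ℕ) c := by
      have := DFunLike.congr_fun h c
      simpa [Finsupp.single_eq_pi_single] using this
    rcases hD with rfl | rfl <;>
    · rcases Finset.mem_union.1 (support_add hm) with h | h <;>
      · obtain ⟨k, hk, h⟩ := exists_mem_support_of_mem_support_xD h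
        refine ⟨k, hk, ?_⟩
        have e1 := h4 _ _ _ h 1
        have e2 := h4 _ _ _ h 2
        have e3 := h4 _ _ _ h 3
        simp at e1 e2 e3
        unfold monomialWeight
        omega
  obtain ⟨k, hk, hlt⟩ := key
  exact hlt.trans_le (Finset.le_sup hk)

theorem exists_highestWeight {S : Submodule ℂ PolyAlg} (hl : ∀ f ∈ S, leftRaise f ∈ S)
    (hr : ∀ f ∈ S, rightRaise f ∈ S) {f : PolyAlg} (hf : f ∈ S) (h0 : f ≠ 0) :
    ∃ g ∈ S, g ≠ 0 ∧ leftRaise g = 0 ∧ rightRaise g = 0 := by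
  induction hn : f.support.sup monomialWeight using Nat.strong_induction_on generalizing f with
  | _ n ih =>
  subst hn
  by_cases h1 : leftRaise f = 0
  · by_cases h2 : rightRaise f = 0
    · exact ⟨f, hf, h0, h1, h2⟩
    · exact ih _ (sup_monomialWeight_lt (Or.inr rfl) h2) (hr f hf) h2 rfl
  · exact ih _ (sup_monomialWeight_lt (Or.inl rfl) h1) (hl f hf) h1 rfl

/-- A highest weight vector of `S` is `R₁^l h` with `h` harmonic. As `R₁` is injective and commutes
with raising, `h` is itself a highest weight vector, hence a multiple of a power of `x`. -/
theorem opR_pow_X_pow_mem {N l : ℕ} {S : Submodule ℂ PolyAlg} (hS : S ≤ polySummand N l)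
    (h0 : S ≠ ⊥) (hl : ∀ f ∈ S, leftRaise f ∈ S) (hr : ∀ f ∈ S, rightRaise f ∈ S) :
    (opR ^ l) (X 0 ^ (N - 2 * l)) ∈ S := by
  obtain ⟨f, hf, hf0⟩ := S.ne_bot_iff.1 h0
  obtain ⟨g, hg, hg0, h1, h2⟩ := exists_highestWeight hl hr hf hf0
  obtain ⟨h, ⟨hL, hh⟩, rfl⟩ := hS hg
  rw [map_opR_pow leftRaise_opR] at h1
  rw [map_opR_pow rightRaise_opR] at h2
  obtain ⟨c, rfl⟩ := eq_smul_X_pow_of_highestWeight hh hL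
    (opR_pow_injective l (h1.trans (map_zero _).symm))
    (opR_pow_injective l (h2.trans (map_zero _).symm))
  have hc : c ≠ 0 := by
    rintro rfl
    simp at hg0
  rw [map_smul] at hg
  exact (Submodule.smul_mem_iff _ hc).1 hg

theorem opR_pow_X_pow_mem_polySummand (N l : ℕ) :
    (opR ^ l) (X 0 ^ (N - 2 * l)) ∈ polySummand N l := by
  refine ⟨_, ⟨?_, isHomogeneous_X_pow 0 _⟩, rfl⟩
  change opL _ = 0
  rw [opL_apply, pderiv_pow, pderiv_pow]
  simp

theorem opR_pow_X_pow_ne_zero (l n : ℕ) : (opR ^ l) (X 0 ^ n) ≠ 0 := fun h =>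
  pow_ne_zero n (X_ne_zero 0) (opR_pow_injective l (h.trans (map_zero _).symm))

/-! ## The matrix entries of `A`, `A*` and `ϑ(f)` -/

/-- The vertex obtained from `b` by changing the sign of the `i`-th coordinate. -/
def flipAt {N : ℕ} (b : Vertex N) (i : Fin N) : Vertex N := Function.update b i (-b i)

theorem neighborFinset_eq_image {N : ℕ} (b : Vertex N) :
    (hypercube N).neighborFinset b = Finset.univ.image (flipAt b) := by
  ext c
  rw [SimpleGraph.mem_neighborFinset]
  change hammingDist b c = 1 ↔ _
  simp only [Finset.mem_image, Finset.mem_univ, true_and, hammingDist, Finset.card_eq_one]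
  refine exists_congr fun i => ?_
  constructor
  · intro h
    have h' (j : Fin N) : b j ≠ c j ↔ j = i := by
      simpa using Finset.ext_iff.1 h j
    funext j
    by_cases hj : j = i
    · subst hj
      rw [flipAt, Function.update_self]
      exact (Int.units_ne_iff_eq_neg.1 ((h' j).2 rfl).symm).symm
    · rw [flipAt, Function.update_of_ne hj]
      by_contra hne
      exact hj ((h' j).1 hne)
  · rintro rfl
    ext j
    by_cases hj : j = i
    · subst hj
      simp [flipAt, Int.units_ne_iff_eq_neg]
    · rw [Finset.mem_filter]
      simp [flipAt, hj]

theorem flipAt_injective {N : ℕ} (b : Vertex N) : Function.Injective (flipAt b) := by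
  intro i j h
  by_contra hij
  have := congr_fun h i
  rw [flipAt, flipAt, Function.update_self, Function.update_of_ne hij] at this
  exact Int.units_ne_iff_eq_neg.2 rfl this

theorem sum_neighborFinset {N : ℕ} {M : Type*} [AddCommMonoid M] (b : Vertex N)
    (F : Vertex N → M) : ∑ ξ ∈ (hypercube N).neighborFinset b, F ξ = ∑ i, F (flipAt b i) := by
  rw [neighborFinset_eq_image, Finset.sum_image fun i _ j _ h => flipAt_injective b h]

theorem adjMap_vertexBasis {N : ℕ} (c : Vertex N) :
    adjMap N (vertexBasis N c) = ∑ i, vertexBasis N (flipAt c i) := by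
  rw [adjMap, Module.Basis.constr_basis, sum_neighborFinset]

theorem adjMap_apply {N : ℕ} (v : StdModule N) (b : Vertex N) :
    adjMap N v b = ∑ i, v (flipAt b i) := by
  rw [adjMap, Module.Basis.constr_apply_fintype, Finset.sum_apply, ← sum_neighborFinset]
  rw [← Finset.sum_filter_add_sum_filter_not Finset.univ (· ∈ (hypercube N).neighborFinset b)]
  rw [Finset.filter_mem_eq_inter, Finset.univ_inter, Finset.sum_eq_zero (s := Finset.filter _ _),
    add_zero]
  · refine Finset.sum_congr rfl fun ξ hξ => ?_
    have : b ∈ (hypercube N).neighborFinset ξ := by simpa [SimpleGraph.adj_comm] using hξ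
    simp [Finset.sum_apply, Pi.single_apply, this, -SimpleGraph.mem_neighborFinset]
  · intro ξ hξ
    have : b ∉ (hypercube N).neighborFinset ξ := by simpa [SimpleGraph.adj_comm] using hξ
    simp [Finset.sum_apply, Pi.single_apply, this, -SimpleGraph.mem_neighborFinset]

theorem dualAdjMap_vertexBasis {N : ℕ} (ϰ c : Vertex N) :
    dualAdjMap N ϰ (vertexBasis N c) = ((N : ℂ) - 2 * hammingDist c ϰ) • vertexBasis N c := by
  rw [dualAdjMap, Module.Basis.constr_basis, hypercube_dist]

theorem dualAdjMap_apply {N : ℕ} (ϰ : Vertex N) (v : StdModule N) (b : Vertex N) :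
    dualAdjMap N ϰ v b = ((N : ℂ) - 2 * hammingDist b ϰ) * v b := by
  rw [dualAdjMap, Module.Basis.constr_apply_fintype, Finset.sum_apply, Finset.sum_eq_single b]
  · simp [hypercube_dist, mul_comm]
  · intro ξ _ hξ
    simp [hξ.symm]
  · simp

/-- The class `0, 1, 2, 3` of a coordinate with entries `e, b, c` in the definition of the
profile. -/
def coordType (e b c : ℤˣ) : Fin 4 := if b = c then if e = b then 0 else 1 else if c = e then 2 else 3

/-- The profile as an exponent vector. -/
def prof {N : ℕ} (ϰ b c : Vertex N) : Fin 4 →₀ ℕ :=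
  ∑ i, Finsupp.single (coordType (ϰ i) (b i) (c i)) 1

theorem coe_prof {N : ℕ} (ϰ b c : Vertex N) : ⇑(prof ϰ b c) = profile ϰ b c := by
  have key : ∀ e b c : ℤˣ, (coordType e b c = 0 ↔ e = b ∧ b = c) ∧
      (coordType e b c = 1 ↔ e ≠ b ∧ b = c) ∧ (coordType e b c = 2 ↔ b ≠ c ∧ c = e) ∧
      (coordType e b c = 3 ↔ c ≠ e ∧ e = b) := by
    decide
  funext a
  rw [prof, Finsupp.finsetSum_apply]
  simp only [Finsupp.single_apply, Finset.sum_boole, Nat.cast_id]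
  fin_cases a <;> simp [profile, key]

/-- Grouping coordinates by class turns a sum over `Fin N` into four terms weighted by the profile,
the shape in which `M_a D_b` acts on Taylor coefficients. -/
theorem sum_prof {N : ℕ} (ϰ b c : Vertex N) (F : Fin 4 → ℂ) :
    ∑ a, (prof ϰ b c a : ℂ) * F a = ∑ i, F (coordType (ϰ i) (b i) (c i)) := by
  simp only [prof, Finsupp.finsetSum_apply, Nat.cast_sum, Finset.sum_mul]
  rw [Finset.sum_comm]
  refine Finset.sum_congr rfl fun i _ => ?_
  simp [Finsupp.single_apply]

/-- Negating `b i` exchanges classes `0 ↔ 2` and `1 ↔ 3`. The subtraction is genuine, as the class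
of coordinate `i` occurs in the profile. -/
theorem prof_flipAt_left {N : ℕ} (ϰ b c : Vertex N) (i : Fin N) :
    prof ϰ (flipAt b i) c = prof ϰ b c - Finsupp.single (coordType (ϰ i) (b i) (c i)) 1 +
      Finsupp.single (![2, 3, 0, 1] (coordType (ϰ i) (b i) (c i))) 1 := by
  have key : ∀ e b c : ℤˣ, coordType e (-b) c = ![2, 3, 0, 1] (coordType e b c) := by decide
  rw [prof, prof, ← Finset.add_sum_erase _ _ (Finset.mem_univ i),
    ← Finset.add_sum_erase (a := i) (s := Finset.univ) _ (Finset.mem_univ i),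
    add_tsub_cancel_left, add_comm]
  congr 1
  · refine Finset.sum_congr rfl fun j hj => ?_
    rw [flipAt, Function.update_of_ne (Finset.ne_of_mem_erase hj)]
  · rw [flipAt, Function.update_self, key]

theorem prof_flipAt_right {N : ℕ} (ϰ b c : Vertex N) (i : Fin N) :
    prof ϰ b (flipAt c i) = prof ϰ b c - Finsupp.single (coordType (ϰ i) (b i) (c i)) 1 +
      Finsupp.single (![3, 2, 1, 0] (coordType (ϰ i) (b i) (c i))) 1 := by
  have key : ∀ e b c : ℤˣ, coordType e b (-c) = ![3, 2, 1, 0] (coordType e b c) := by decide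
  rw [prof, prof, ← Finset.add_sum_erase _ _ (Finset.mem_univ i),
    ← Finset.add_sum_erase (a := i) (s := Finset.univ) _ (Finset.mem_univ i),
    add_tsub_cancel_left, add_comm]
  congr 1
  · refine Finset.sum_congr rfl fun j hj => ?_
    rw [flipAt, Function.update_of_ne (Finset.ne_of_mem_erase hj)]
  · rw [flipAt, Function.update_self, key]

theorem sub_two_mul_hammingDist {N : ℕ} (ϰ b : Vertex N) :
    (N : ℂ) - 2 * hammingDist b ϰ = ∑ i, if b i = ϰ i then (1 : ℂ) else -1 := by
  have h : ∀ i, (if b i = ϰ i then (1 : ℂ) else -1) = 1 - 2 * if b i ≠ ϰ i then 1 else 0 := by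
    intro i
    split_ifs <;> simp_all
    norm_num
  simp only [h, Finset.sum_sub_distrib, ← Finset.mul_sum, Finset.sum_boole]
  simp [hammingDist]

/-- The value at `0` of the partial derivative of `f` with multi-index `p`. -/
def taylorCoeff (f : PolyAlg) (p : Fin 4 →₀ ℕ) : ℂ := (monomialFactorial p : ℂ) * coeff p f

/-- On Taylor coefficients `M_a D_b` is a weighted shift. If `p a = 0` the subtraction truncates,
but the factor `p a` vanishes. -/
theorem taylorCoeff_xD (a b : Fin 4) (f : PolyAlg) (p : Fin 4 →₀ ℕ) :
    taylorCoeff (xD a b f) p =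
      (p a : ℂ) * taylorCoeff f (p - Finsupp.single a 1 + Finsupp.single b 1) := by
  classical
  rw [taylorCoeff, xD_apply, coeff_X_mul']
  split_ifs with ha
  · have h1 : p - Finsupp.single a 1 + Finsupp.single a 1 = p := by
      rw [tsub_add_cancel_of_le]
      rw [Finsupp.single_le_iff]
      exact Nat.one_le_iff_ne_zero.2 (Finsupp.mem_support_iff.1 ha)
    generalize p - Finsupp.single a 1 = q at *
    subst h1
    rw [taylorCoeff, coeff_pderiv, monomialFactorial_add_single, monomialFactorial_add_single]
    simp
    ring
  · rw [Finsupp.notMem_support_iff.1 ha]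
    simp

theorem taylorCoeff_xD_self (a : Fin 4) (f : PolyAlg) (p : Fin 4 →₀ ℕ) :
    taylorCoeff (xD a a f) p = (p a : ℂ) * taylorCoeff f p := by
  rw [taylorCoeff_xD]
  by_cases ha : p a = 0
  · simp [ha]
  · rw [tsub_add_cancel_of_le]
    rw [Finsupp.single_le_iff]
    exact Nat.one_le_iff_ne_zero.2 ha

@[simp] theorem taylorCoeff_add (f g : PolyAlg) (p : Fin 4 →₀ ℕ) :
    taylorCoeff (f + g) p = taylorCoeff f p + taylorCoeff g p := by
  simp [taylorCoeff, mul_add]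

@[simp] theorem taylorCoeff_sub (f g : PolyAlg) (p : Fin 4 →₀ ℕ) :
    taylorCoeff (f - g) p = taylorCoeff f p - taylorCoeff g p := by
  simp [taylorCoeff, mul_sub]

/-- The extension of `ϑ` to `P` that vanishes on the other homogeneous components. -/
def theta (N : ℕ) (ϰ : Vertex N) : PolyAlg →ₗ[ℂ] Module.End ℂ (StdModule N) :=
  epsMap N ϰ ∘ₗ (basisMonomials (Fin 4) ℂ).constr ℂ fun m =>
    ((Real.sqrt ((N.factorial : ℝ) * 2 ^ N) : ℝ) : ℂ) • dualProfileVec N m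

/-- The normalization constant in the matrix entries of `ϑ(f)`. -/
def thetaConst (N : ℕ) : ℂ :=
  ((Real.sqrt ((N.factorial : ℝ) * 2 ^ N) : ℝ) : ℂ) / ((N.factorial : ℂ) * 2 ^ N) *
    ((Real.sqrt (2 ^ N) : ℝ) : ℂ)

theorem thetaConst_ne_zero (N : ℕ) : thetaConst N ≠ 0 := by
  have h1 : Real.sqrt ((N.factorial : ℝ) * 2 ^ N) ≠ 0 := by positivity
  have h2 : Real.sqrt (2 ^ N) ≠ 0 := by positivity
  have h3 : (N.factorial : ℂ) ≠ 0 := Nat.cast_ne_zero.2 N.factorial_ne_zero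
  simp only [thetaConst]
  refine mul_ne_zero (div_ne_zero ?_ ?_) ?_
  · exact_mod_cast h1
  · exact mul_ne_zero h3 (by simp)
  · exact_mod_cast h2

theorem elemMap_vertexBasis_apply {N : ℕ} (x y b c : Vertex N) :
    elemMap x y (vertexBasis N c) b = if c = y ∧ b = x then 1 else 0 := by
  rw [elemMap, Module.Basis.constr_basis]
  by_cases h : c = y
  · simp [h, Pi.single_apply]
  · simp [h]

theorem epsMap_profileVec_apply {N : ℕ} (ϰ b c : Vertex N) (m : Fin 4 →₀ ℕ) :
    epsMap N ϰ (profileVec N m) (vertexBasis N c) b =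
      if prof ϰ b c = m then ((Real.sqrt (2 ^ N) : ℝ) : ℂ) else 0 := by
  rw [profileVec, map_sum, LinearMap.sum_apply, Finset.sum_apply]
  simp only [epsMap, Module.Basis.constr_basis]
  rw [Finset.sum_filter, Finset.sum_eq_single (ϰ, b, c)]
  · simp [← coe_prof, elemMap_vertexBasis_apply, -Pi.basisFun_apply]
  · rintro ⟨x, y, z⟩ _ hne
    split_ifs with h1 h2
    · simp only at h2
      subst h2
      rw [LinearMap.smul_apply, Pi.smul_apply, elemMap_vertexBasis_apply, if_neg, smul_zero]
      rintro ⟨rfl, rfl⟩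
      exact hne rfl
    · rfl
    · rfl
  · simp

theorem theta_apply {N : ℕ} (ϰ : Vertex N) (f : PolyAlg) (b c : Vertex N) :
    theta N ϰ f (vertexBasis N c) b = thetaConst N * taylorCoeff f (prof ϰ b c) := by
  rw [theta, LinearMap.comp_apply, Module.Basis.constr_apply, Finsupp.sum, map_sum,
    LinearMap.sum_apply, Finset.sum_apply]
  simp only [dualProfileVec, map_smul, LinearMap.smul_apply, Pi.smul_apply,
    epsMap_profileVec_apply, smul_eq_mul]
  rw [Finset.sum_eq_single (prof ϰ b c)]
  · rw [if_pos rfl, thetaConst, taylorCoeff]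
    change coeff _ f * _ = _
    ring
  · intro m _ hm
    rw [if_neg hm.symm]
    simp
  · intro h
    rw [Finsupp.notMem_support_iff.1 h, zero_mul]

theorem end_ext {N : ℕ} {B C : Module.End ℂ (StdModule N)}
    (h : ∀ b c, B (vertexBasis N c) b = C (vertexBasis N c) b) : B = C :=
  (vertexBasis N).ext fun c => funext fun b => h b c

/-! ## The intertwining relations -/

theorem theta_leftAdj {N : ℕ} (ϰ : Vertex N) (f : PolyAlg) :
    theta N ϰ (leftAdj f) = adjMap N * theta N ϰ f := by
  refine end_ext fun b c => ?_
  rw [Module.End.mul_apply, adjMap_apply]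
  simp only [theta_apply, prof_flipAt_left]
  rw [← Finset.mul_sum, ← sum_prof ϰ b c fun a => taylorCoeff f
    (prof ϰ b c - Finsupp.single a 1 + Finsupp.single (![2, 3, 0, 1] a) 1)]
  simp [leftAdj, Fin.sum_univ_four, -xD_apply, taylorCoeff_xD]

theorem theta_rightAdj {N : ℕ} (ϰ : Vertex N) (f : PolyAlg) :
    theta N ϰ (rightAdj f) = theta N ϰ f * adjMap N := by
  refine end_ext fun b c => ?_
  rw [Module.End.mul_apply, adjMap_vertexBasis, map_sum, Finset.sum_apply]
  simp only [theta_apply, prof_flipAt_right]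
  rw [← Finset.mul_sum, ← sum_prof ϰ b c fun a => taylorCoeff f
    (prof ϰ b c - Finsupp.single a 1 + Finsupp.single (![3, 2, 1, 0] a) 1)]
  simp [rightAdj, Fin.sum_univ_four, -xD_apply, taylorCoeff_xD]

theorem theta_leftDual {N : ℕ} (ϰ : Vertex N) (f : PolyAlg) :
    theta N ϰ (leftDual f) = dualAdjMap N ϰ * theta N ϰ f := by
  refine end_ext fun b c => ?_
  have key : ∀ e b c : ℤˣ, (if b = e then (1 : ℂ) else -1) = ![1, -1, -1, 1] (coordType e b c) := by
    intro e b c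
    rcases Int.units_eq_one_or e with rfl | rfl <;> rcases Int.units_eq_one_or b with rfl | rfl <;>
    rcases Int.units_eq_one_or c with rfl | rfl <;> simp [coordType]
  rw [Module.End.mul_apply, dualAdjMap_apply, sub_two_mul_hammingDist,
    Finset.sum_congr rfl fun i _ => key (ϰ i) (b i) (c i), ← sum_prof]
  simp [leftDual, Fin.sum_univ_four, -xD_apply, taylorCoeff_xD_self, theta_apply,
    -Pi.basisFun_apply]
  ring

theorem theta_rightDual {N : ℕ} (ϰ : Vertex N) (f : PolyAlg) :
    theta N ϰ (rightDual f) = theta N ϰ f * dualAdjMap N ϰ := by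
  refine end_ext fun b c => ?_
  have key : ∀ e b c : ℤˣ, (if c = e then (1 : ℂ) else -1) = ![1, -1, 1, -1] (coordType e b c) := by
    intro e b c
    rcases Int.units_eq_one_or e with rfl | rfl <;> rcases Int.units_eq_one_or b with rfl | rfl <;>
    rcases Int.units_eq_one_or c with rfl | rfl <;> simp [coordType]
  rw [Module.End.mul_apply, dualAdjMap_vertexBasis, sub_two_mul_hammingDist,
    Finset.sum_congr rfl fun i _ => key (ϰ i) (b i) (c i), ← sum_prof]
  simp [rightDual, Fin.sum_univ_four, -xD_apply, taylorCoeff_xD_self, theta_apply,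
    -Pi.basisFun_apply]
  ring

/-! ## `ϑ` is a bijection from `P_N` onto `T` -/

theorem exists_prof_eq {N : ℕ} (ϰ : Vertex N) {m : Fin 4 →₀ ℕ} (hm : ∑ a, m a = N) :
    ∃ b c, prof ϰ b c = m := by
  have hsurj : ∀ (e : ℤˣ) (a : Fin 4), ∃ p : ℤˣ × ℤˣ, coordType e p.1 p.2 = a := by decide
  choose p hp using hsurj
  -- Coordinates are distributed among the classes with multiplicities `m`; each class is attainable
  -- whatever the value of `ϰ i`.
  let e : (Σ a, Fin (m a)) ≃ Fin N := Fintype.equivOfCardEq (by simp [hm])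
  refine ⟨fun i => (p (ϰ i) (e.symm i).1).1, fun i => (p (ϰ i) (e.symm i).1).2, ?_⟩
  simp only [prof, hp]
  rw [e.symm.sum_comp (fun q => Finsupp.single q.1 1), Fintype.sum_sigma]
  ext a
  simp

theorem sum_prof_eq {N : ℕ} (ϰ b c : Vertex N) : ∑ a, prof ϰ b c a = N := by
  have := sum_prof ϰ b c fun _ => 1
  simp only [mul_one, Finset.sum_const, Finset.card_univ, Fintype.card_fin, nsmul_eq_mul] at this
  exact_mod_cast this

theorem theta_injOn {N : ℕ} (ϰ : Vertex N) {f g : PolyAlg} (hf : f ∈ homPoly N)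
    (hg : g ∈ homPoly N) (h : theta N ϰ f = theta N ϰ g) : f = g := by
  rw [← sub_eq_zero, ← map_sub] at h
  rw [← sub_eq_zero]
  have hfg := Submodule.sub_mem _ hf hg
  generalize f - g = k at *
  ext m
  by_contra hne
  rw [coeff_zero] at hne
  have hdeg := hfg hne
  have hm : ∑ a, m a = N := by
    rw [← hdeg, Finsupp.weight_apply, Finsupp.sum_fintype _ _ (by simp)]
    simp
  obtain ⟨b, c, rfl⟩ := exists_prof_eq ϰ hm
  have h0 := theta_apply ϰ k b c
  rw [h, taylorCoeff] at h0
  have hmf : (monomialFactorial (prof ϰ b c) : ℂ) ≠ 0 :=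
    Nat.cast_ne_zero.2 (Finset.prod_ne_zero_iff.2 fun a _ => Nat.factorial_ne_zero _)
  exact mul_ne_zero (thetaConst_ne_zero N) (mul_ne_zero hmf hne) h0.symm

theorem prof_eq_zero_iff {N : ℕ} (ϰ b c : Vertex N) :
    prof ϰ b c 2 = 0 ∧ prof ϰ b c 3 = 0 ↔ b = c := by
  have key : ∀ e b c : ℤˣ, coordType e b c ≠ 2 ∧ coordType e b c ≠ 3 ↔ b = c := by decide
  simp only [prof, Finsupp.finsetSum_apply, Finset.sum_eq_zero_iff, Finset.mem_univ, true_imp_iff,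
    ← forall_and, funext_iff]
  refine forall_congr' fun i => ?_
  rw [← key (ϰ i)]
  simp [Finsupp.single_apply]

/-- The factorials `r! s!` cancel the binomial coefficient to `N!`. The support condition says that
`b = c`, so `(x + y)^N` maps to a scalar matrix. -/
theorem taylorCoeff_add_pow {N : ℕ} {p : Fin 4 →₀ ℕ} (hp : ∑ a, p a = N) :
    taylorCoeff ((X 0 + X 1) ^ N) p = if p 2 = 0 ∧ p 3 = 0 then (N.factorial : ℂ) else 0 := by
  have hterm (k : ℕ) : coeff p (X 0 ^ k * X 1 ^ (N - k) * (N.choose k : PolyAlg)) =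
      if Finsupp.single 0 k + Finsupp.single 1 (N - k) = p then (N.choose k : ℂ) else 0 := by
    rw [X_pow_eq_monomial, X_pow_eq_monomial, monomial_mul, ← map_natCast (C : ℂ →+* PolyAlg),
      mul_comm, C_mul_monomial, coeff_monomial]
    simp
  rw [taylorCoeff, add_pow, coeff_sum]
  simp only [hterm]
  rw [Fin.sum_univ_four] at hp
  split_ifs with h
  · have hN : N - p 0 = p 1 := by omega
    rw [Finset.sum_eq_single (p 0)]
    · rw [if_pos, monomialFactorial, Fin.prod_univ_four, h.1, h.2, ← hN, Nat.factorial_zero]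
      · rw [← Nat.choose_mul_factorial_mul_factorial (show p 0 ≤ N by omega)]
        push_cast
        ring
      · ext a
        fin_cases a <;> simp [hN, h]
    · intro k _ hk
      rw [if_neg]
      intro hpk
      have := DFunLike.congr_fun hpk 0
      simp at this
      exact hk this
    · intro hmem
      exact absurd (Finset.mem_range.2 (by omega)) hmem
  · rw [Finset.sum_eq_zero, mul_zero]
    intro k _
    rw [if_neg]
    rintro rfl
    simp at h

theorem theta_add_pow {N : ℕ} (ϰ : Vertex N) :
    theta N ϰ ((X 0 + X 1) ^ N) = (thetaConst N * N.factorial) • 1 := by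
  refine end_ext fun b c => ?_
  rw [theta_apply, taylorCoeff_add_pow (sum_prof_eq ϰ b c), if_congr (prof_eq_zero_iff ϰ b c) rfl rfl]
  simp [Pi.single_apply]

theorem add_pow_mem (N : ℕ) : (X 0 + X 1 : PolyAlg) ^ N ∈ homPoly N := by
  have := ((isHomogeneous_X ℂ (0 : Fin 4)).add (isHomogeneous_X ℂ (1 : Fin 4))).pow N
  rwa [one_mul] at this

/-- The element of `P_N` that `ϑ` maps to the identity. -/
def thetaOne (N : ℕ) : PolyAlg := (thetaConst N * N.factorial)⁻¹ • (X 0 + X 1) ^ N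

theorem thetaConst_mul_factorial_ne_zero (N : ℕ) : thetaConst N * N.factorial ≠ 0 :=
  mul_ne_zero (thetaConst_ne_zero N) (Nat.cast_ne_zero.2 N.factorial_ne_zero)

theorem theta_thetaOne {N : ℕ} (ϰ : Vertex N) : theta N ϰ (thetaOne N) = 1 := by
  rw [thetaOne, map_smul, theta_add_pow, smul_smul,
    inv_mul_cancel₀ (thetaConst_mul_factorial_ne_zero N), one_smul]

theorem thetaOne_mem (N : ℕ) : thetaOne N ∈ homPoly N := Submodule.smul_mem _ _ (add_pow_mem N)

theorem leftAdj_mem {N : ℕ} {f : PolyAlg} (hf : f ∈ homPoly N) : leftAdj f ∈ homPoly N :=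
  add_mem (add_mem (add_mem (xD_mem _ _ hf) (xD_mem _ _ hf)) (xD_mem _ _ hf)) (xD_mem _ _ hf)

theorem leftDual_mem {N : ℕ} {f : PolyAlg} (hf : f ∈ homPoly N) : leftDual f ∈ homPoly N :=
  add_mem (sub_mem (sub_mem (xD_mem _ _ hf) (xD_mem _ _ hf)) (xD_mem _ _ hf)) (xD_mem _ _ hf)

theorem exists_theta_eq {N : ℕ} {ϰ : Vertex N} {t : Module.End ℂ (StdModule N)}
    (ht : t ∈ subconstituentAlgebra N ϰ) : ∃ f ∈ homPoly N, theta N ϰ f = t := by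
  -- Strengthened to stability of the image under left multiplication, so that products pass through
  -- the induction; the preimage of `1` then yields `t`.
  have h : ∀ f ∈ homPoly N, ∃ g ∈ homPoly N, theta N ϰ g = t * theta N ϰ f := by
    induction ht using Algebra.adjoin_induction with
    | mem t ht =>
      intro f hf
      rcases ht with rfl | rfl
      · exact ⟨_, leftAdj_mem hf, theta_leftAdj ϰ f⟩
      · exact ⟨_, leftDual_mem hf, theta_leftDual ϰ f⟩
    | algebraMap c =>
      intro f hf
      exact ⟨c • f, Submodule.smul_mem _ _ hf, by rw [map_smul, Algebra.smul_def]⟩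
    | add s t _ _ hs ht =>
      intro f hf
      obtain ⟨g, hg, h1⟩ := hs f hf
      obtain ⟨k, hk, h2⟩ := ht f hf
      exact ⟨g + k, add_mem hg hk, by rw [map_add, h1, h2, add_mul]⟩
    | mul s t _ _ hs ht =>
      intro f hf
      obtain ⟨g, hg, h1⟩ := ht f hf
      obtain ⟨k, hk, h2⟩ := hs g hg
      exact ⟨k, hk, by rw [h2, h1, mul_assoc]⟩
  obtain ⟨g, hg, h1⟩ := h _ (thetaOne_mem N)
  exact ⟨g, hg, by rw [h1, theta_thetaOne, mul_one]⟩

theorem leftRaise_eq : leftRaise =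
    (1 / 2 : ℂ) • (leftAdj - (1 / 2 : ℂ) • (leftAdj * leftDual - leftDual * leftAdj)) := by
  rw [leftAdj_leftDual_comm, leftRaise, leftAdj, leftAdjComm]
  module

theorem rightRaise_eq : rightRaise =
    (1 / 2 : ℂ) • (rightAdj - (1 / 2 : ℂ) • (rightAdj * rightDual - rightDual * rightAdj)) := by
  rw [rightAdj_rightDual_comm, rightRaise, rightAdj, rightAdjComm]
  module

/-- The lowering operator that corresponds to left multiplication. -/
def leftLower : Module.End ℂ PolyAlg := xD 2 0 + xD 1 3

theorem leftLower_eq : leftLower =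
    (1 / 2 : ℂ) • (leftAdj + (1 / 2 : ℂ) • (leftAdj * leftDual - leftDual * leftAdj)) := by
  rw [leftAdj_leftDual_comm, leftLower, leftAdj, leftAdjComm]
  module

/-- The operator that counts the coordinates in which the first vertex differs from the base
vertex. -/
def leftCount : Module.End ℂ PolyAlg := xD 1 1 + xD 2 2

theorem leftCount_eq : leftCount = (1 / 2 : ℂ) • (eulerOp - leftDual) := by
  rw [leftCount, eulerOp, leftDual, Fin.sum_univ_four]
  module

section Generation

variable {N : ℕ} {S : Submodule ℂ PolyAlg}

theorem leftRaise_mem_of_stable (hA : ∀ f ∈ S, leftAdj f ∈ S) (hD : ∀ f ∈ S, leftDual f ∈ S)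
    {f : PolyAlg} (hf : f ∈ S) : leftRaise f ∈ S := by
  simp only [leftRaise_eq, LinearMap.smul_apply, LinearMap.sub_apply,
    Module.End.mul_apply]
  exact S.smul_mem _ (S.sub_mem (hA f hf) (S.smul_mem _
    (S.sub_mem (hA _ (hD f hf)) (hD _ (hA f hf)))))

theorem rightRaise_mem_of_stable (hA : ∀ f ∈ S, rightAdj f ∈ S) (hD : ∀ f ∈ S, rightDual f ∈ S)
    {f : PolyAlg} (hf : f ∈ S) : rightRaise f ∈ S := by
  simp only [rightRaise_eq, LinearMap.smul_apply, LinearMap.sub_apply,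
    Module.End.mul_apply]
  exact S.smul_mem _ (S.sub_mem (hA f hf) (S.smul_mem _
    (S.sub_mem (hA _ (hD f hf)) (hD _ (hA f hf)))))

theorem leftLower_mem_of_stable (hA : ∀ f ∈ S, leftAdj f ∈ S) (hD : ∀ f ∈ S, leftDual f ∈ S)
    {f : PolyAlg} (hf : f ∈ S) : leftLower f ∈ S := by
  simp only [leftLower_eq, LinearMap.smul_apply, LinearMap.sub_apply, LinearMap.add_apply,
    Module.End.mul_apply]
  exact S.smul_mem _ (S.add_mem (hA f hf) (S.smul_mem _
    (S.sub_mem (hA _ (hD f hf)) (hD _ (hA f hf)))))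

theorem leftCount_mem_of_stable (hD : ∀ f ∈ S, leftDual f ∈ S)
    {f : PolyAlg} (hf : f ∈ S) (hN : f ∈ homPoly N) : leftCount f ∈ S := by
  rw [leftCount_eq, LinearMap.smul_apply, LinearMap.sub_apply, eulerOp_apply_of_mem hN]
  exact S.smul_mem _ (S.sub_mem (S.smul_mem _ hf) (hD f hf))

/-- The product `(x + y)^k y^a z^b w^c`. -/
def shiftedMonomial (k a b c : ℕ) : PolyAlg := (X 0 + X 1) ^ k * X 1 ^ a * X 2 ^ b * X 3 ^ c

theorem shiftedMonomial_mem_homPoly (k a b c : ℕ) :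
    shiftedMonomial k a b c ∈ homPoly (k + a + b + c) :=
  (((add_pow_mem k).mul (isHomogeneous_X_pow _ _)).mul (isHomogeneous_X_pow _ _)).mul
    (isHomogeneous_X_pow _ _)

theorem leftCount_shiftedMonomial (k a b c : ℕ) : leftCount (shiftedMonomial (k + 1) a b c) =
    (k + 1 : ℂ) • shiftedMonomial k (a + 1) b c + (a + b : ℂ) • shiftedMonomial (k + 1) a b c := by
  have h (n : ℕ) (i : Fin 4) : (X i * ((n : PolyAlg) * X i ^ (n - 1)) : PolyAlg) =
      (n : PolyAlg) * X i ^ n := by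
    rcases n with _ | n
    · simp
    · simp; ring
  simp only [leftCount, shiftedMonomial, LinearMap.add_apply, xD_apply, pderiv_mul, pderiv_pow,
    map_add, pderiv_X, Pi.single_apply, smul_eq_C_mul, map_natCast, map_one]
  simp
  linear_combination (X 0 + X 1) ^ (k + 1) * X 2 ^ b * X 3 ^ c * h a 1 +
    (X 0 + X 1) ^ (k + 1) * X 1 ^ a * X 3 ^ c * h b 2

theorem leftLower_shiftedMonomial (k a b c : ℕ) : leftLower (shiftedMonomial (k + 1) a b c) =
    (k + 1 : ℂ) • shiftedMonomial k a (b + 1) c +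
      (c : ℂ) • shiftedMonomial (k + 1) (a + 1) b (c - 1) := by
  simp only [leftLower, shiftedMonomial, LinearMap.add_apply, xD_apply, pderiv_mul, pderiv_pow,
    map_add, pderiv_X, Pi.single_apply, smul_eq_C_mul, map_natCast, map_one]
  simp
  ring

theorem leftRaise_shiftedMonomial (k c : ℕ) : leftRaise (shiftedMonomial (k + 1) 0 0 c) =
    (k + 1 : ℂ) • shiftedMonomial k 0 0 (c + 1) := by
  simp only [leftRaise, shiftedMonomial, LinearMap.add_apply, xD_apply, pderiv_mul, pderiv_pow,
    map_add, pderiv_X, Pi.single_apply, smul_eq_C_mul, map_natCast, map_one]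
  simp
  ring

/-- Counting, lowering and raising trade one factor `x + y` for `y`, `z` and `w` respectively,
modulo terms with smaller `a + b + c`. Raising is used only while `a = b = 0`, where it yields no
extra term. -/
theorem shiftedMonomial_mem (hA : ∀ f ∈ S, leftAdj f ∈ S) (hD : ∀ f ∈ S, leftDual f ∈ S)
    (h1 : (X 0 + X 1) ^ N ∈ S) {k a b c : ℕ} (hN : k + a + b + c = N) :
    shiftedMonomial k a b c ∈ S := by
  induction hd : a + b + c using Nat.strong_induction_on generalizing k a b c with
  | _ d ih =>
  subst hd
  have hk : (k + 1 : ℂ) ≠ 0 := Nat.cast_add_one_ne_zero k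
  rcases a with _ | a
  · rcases b with _ | b
    · rcases c with _ | c
      · obtain rfl : k = N := by omega
        simpa [shiftedMonomial] using h1
      · have hg : shiftedMonomial (k + 1) 0 0 c ∈ S := ih _ (by omega) (by omega) rfl
        have h := leftRaise_mem_of_stable hA hD hg
        rw [leftRaise_shiftedMonomial] at h
        exact (S.smul_mem_iff hk).1 h
    · have hg : shiftedMonomial (k + 1) 0 b c ∈ S := ih _ (by omega) (by omega) rfl
      have h := leftLower_mem_of_stable hA hD hg
      rw [leftLower_shiftedMonomial] at h
      have h2 : (c : ℂ) • shiftedMonomial (k + 1) (0 + 1) b (c - 1) ∈ S := by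
        rcases c with _ | c
        · simp
        · exact S.smul_mem _ (ih _ (by omega) (by omega) rfl)
      exact (S.smul_mem_iff hk).1 ((S.add_mem_iff_left h2).1 h)
  · have hg : shiftedMonomial (k + 1) a b c ∈ S := ih _ (by omega) (by omega) rfl
    have h := leftCount_mem_of_stable hD hg (shiftedMonomial_mem_homPoly _ _ _ _)
    rw [leftCount_shiftedMonomial] at h
    exact (S.smul_mem_iff hk).1 ((S.add_mem_iff_left (S.smul_mem _ hg)).1 h)

theorem homPoly_le_of_stable (hA : ∀ f ∈ S, leftAdj f ∈ S) (hD : ∀ f ∈ S, leftDual f ∈ S)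
    (h1 : (X 0 + X 1) ^ N ∈ S) : homPoly N ≤ S := by
  have h (r : ℕ) : ∀ k a b c : ℕ, r + k + a + b + c = N →
      X 0 ^ r * shiftedMonomial k a b c ∈ S := by
    induction r with
    | zero =>
      intro k a b c hN
      rw [pow_zero, one_mul]
      exact shiftedMonomial_mem hA hD h1 (by omega)
    | succ r ih =>
      intro k a b c hN
      -- Powers of `x` are recovered from `x = (x + y) - y`.
      have : X 0 ^ (r + 1) * shiftedMonomial k a b c = X 0 ^ r * shiftedMonomial (k + 1) a b c -
          X 0 ^ r * shiftedMonomial k (a + 1) b c := by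
        simp only [shiftedMonomial]
        ring
      rw [this]
      exact S.sub_mem (ih _ _ _ _ (by omega)) (ih _ _ _ _ (by omega))
  intro f hf
  rw [f.as_sum]
  refine S.sum_mem fun m hm => ?_
  have hdeg := hf (mem_support_iff.1 hm)
  have hm : ∑ a, m a = N := by
    rw [← hdeg, Finsupp.weight_apply, Finsupp.sum_fintype _ _ (by simp)]
    simp
  rw [Fin.sum_univ_four] at hm
  rw [monomial_eq, Finsupp.prod_fintype _ _ (by simp), Fin.prod_univ_four, ← smul_eq_C_mul]
  have h2 := h (m 0) 0 (m 1) (m 2) (m 3) (by omega)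
  rw [shiftedMonomial, pow_zero, one_mul, ← mul_assoc, ← mul_assoc] at h2
  exact S.smul_mem _ h2

end Generation

theorem theta_mem {N : ℕ} (ϰ : Vertex N) {f : PolyAlg} (hf : f ∈ homPoly N) :
    theta N ϰ f ∈ subconstituentAlgebra N ϰ := by
  have hA : adjMap N ∈ subconstituentAlgebra N ϰ := Algebra.subset_adjoin (by simp)
  have hD : dualAdjMap N ϰ ∈ subconstituentAlgebra N ϰ := Algebra.subset_adjoin (by simp)
  refine homPoly_le_of_stable (N := N)
    (S := (Subalgebra.toSubmodule (subconstituentAlgebra N ϰ)).comap (theta N ϰ)) ?_ ?_ ?_ hf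
  · intro f hf
    rw [Submodule.mem_comap, theta_leftAdj]
    exact (subconstituentAlgebra N ϰ).mul_mem hA hf
  · intro f hf
    rw [Submodule.mem_comap, theta_leftDual]
    exact (subconstituentAlgebra N ϰ).mul_mem hD hf
  · rw [Submodule.mem_comap, theta_add_pow]
    exact Submodule.smul_mem _ _ (one_mem (subconstituentAlgebra N ϰ))

theorem map_theta_homPoly {N : ℕ} (ϰ : Vertex N) :
    (homPoly N).map (theta N ϰ) = Subalgebra.toSubmodule (subconstituentAlgebra N ϰ) := by
  refine le_antisymm (Submodule.map_le_iff_le_comap.2 fun f hf => theta_mem ϰ hf) fun t ht => ?_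
  exact exists_theta_eq ht

/-! ## The spectral decomposition of `φ` -/

theorem theta_capelliOp_left {N : ℕ} (ϰ : Vertex N) (f : PolyAlg) :
    theta N ϰ (capelliOp f) = phiMap N ϰ * theta N ϰ f := by
  rw [← casimir_left]
  simp only [casimir, phiMap, pow_two, LinearMap.smul_apply, LinearMap.add_apply,
    LinearMap.sub_apply, Module.End.mul_apply, map_smul, map_add, map_sub, theta_leftAdj,
    theta_leftDual, smul_mul_assoc, add_mul, sub_mul, mul_sub, mul_assoc]

theorem theta_capelliOp_right {N : ℕ} (ϰ : Vertex N) (f : PolyAlg) :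
    theta N ϰ (capelliOp f) = theta N ϰ f * phiMap N ϰ := by
  rw [← casimir_right]
  simp only [casimir, phiMap, pow_two, LinearMap.smul_apply, LinearMap.add_apply,
    LinearMap.sub_apply, Module.End.mul_apply, map_smul, map_add, map_sub, theta_rightAdj,
    theta_rightDual, mul_smul_comm, mul_add, sub_mul, mul_sub, mul_assoc]
  -- Right multiplication reverses products and negates the commutator, but its square is unchanged.
  generalize theta N ϰ f = M, adjMap N = A, dualAdjMap N ϰ = D
  refine congrArg _ (congrArg _ ?_)
  abel

theorem phiMap_mul_comm {N : ℕ} {ϰ : Vertex N} {t : Module.End ℂ (StdModule N)}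
    (ht : t ∈ subconstituentAlgebra N ϰ) : phiMap N ϰ * t = t * phiMap N ϰ := by
  obtain ⟨f, -, rfl⟩ := exists_theta_eq ht
  rw [← theta_capelliOp_left, theta_capelliOp_right]

theorem phiMap_mul_theta {N l : ℕ} (ϰ : Vertex N) (hl : l ≤ N / 2) {f : PolyAlg}
    (hf : f ∈ polySummand N l) :
    phiMap N ϰ * theta N ϰ f = phiEigenvalue N l • theta N ϰ f := by
  rw [← theta_capelliOp_left, capelliOp_apply_of_mem hl hf, map_smul]

theorem theta_apply_mem_eigenspace {N l : ℕ} (ϰ : Vertex N) (hl : l ≤ N / 2) {f : PolyAlg}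
    (hf : f ∈ polySummand N l) (v : StdModule N) :
    theta N ϰ f v ∈ (phiMap N ϰ).eigenspace (phiEigenvalue N l) :=
  Module.End.mem_eigenspace_iff.2 (LinearMap.congr_fun (phiMap_mul_theta ϰ hl hf) v)

theorem exists_sum_theta_eq {N : ℕ} {ϰ : Vertex N} {t : Module.End ℂ (StdModule N)}
    (ht : t ∈ subconstituentAlgebra N ϰ) : ∃ h : ℕ → PolyAlg,
      (∀ l ≤ N / 2, h l ∈ polySummand N l) ∧
        ∑ l ∈ Finset.range (N / 2 + 1), theta N ϰ (h l) = t := by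
  obtain ⟨f, hf, rfl⟩ := exists_theta_eq ht
  obtain ⟨h, hh, rfl⟩ := exists_harmonic_decomposition hf
  exact ⟨h, hh, (map_sum _ _ _).symm⟩

theorem isDiagonalizableMap_phiMap {N : ℕ} (ϰ : Vertex N) :
    IsDiagonalizableMap (phiMap N ϰ) := by
  obtain ⟨h, hh, h1⟩ := exists_sum_theta_eq (one_mem (subconstituentAlgebra N ϰ))
  refine eq_top_iff.2 fun v _ => ?_
  rw [← Module.End.one_apply v (R := ℂ), ← h1, LinearMap.sum_apply]
  refine Submodule.sum_mem _ fun l hl => ?_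
  have := Finset.mem_range.1 hl
  exact Submodule.mem_iSup_of_mem _
    (theta_apply_mem_eigenspace ϰ (by omega) (hh l (by omega)) v)

theorem theta_opR_pow_X_pow_ne_zero {N l : ℕ} (ϰ : Vertex N) (hl : l ≤ N / 2) :
    theta N ϰ ((opR ^ l) (X 0 ^ (N - 2 * l))) ≠ 0 := fun h =>
  opR_pow_X_pow_ne_zero l (N - 2 * l) (theta_injOn ϰ
    (polySummand_le hl (opR_pow_X_pow_mem_polySummand N l)) (zero_mem _)
    (h.trans (map_zero _).symm))

theorem hasEigenvalue_phiMap_iff {N : ℕ} (ϰ : Vertex N) (μ : ℂ) :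
    (phiMap N ϰ).HasEigenvalue μ ↔ ∃ l : ℕ, l ≤ N / 2 ∧ μ = phiEigenvalue N l := by
  constructor
  · intro hμ
    by_contra! hne
    obtain ⟨v, hv⟩ := hμ.exists_hasEigenvector
    obtain ⟨h, hh, h1⟩ := exists_sum_theta_eq (one_mem (subconstituentAlgebra N ϰ))
    apply hv.2
    rw [← Module.End.one_apply v (R := ℂ), ← h1, LinearMap.sum_apply]
    refine Finset.sum_eq_zero fun l hl => ?_
    have hl' : l ≤ N / 2 := by
      have := Finset.mem_range.1 hl
      omega
    -- By centrality `φ` acts on `ϑ(h l) v` both by `λ_l` and by `μ`, so every component of `v`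
    -- vanishes.
    have e1 := LinearMap.congr_fun (phiMap_mul_theta ϰ hl' (hh l hl')) v
    rw [← theta_capelliOp_left, theta_capelliOp_right, Module.End.mul_apply, hv.apply_eq_smul,
      map_smul, LinearMap.smul_apply, ← sub_eq_zero, ← sub_smul] at e1
    exact (smul_eq_zero.1 e1).resolve_left (sub_ne_zero.2 (hne l hl'))
  · rintro ⟨l, hl, rfl⟩
    obtain ⟨v, hv⟩ : ∃ v, theta N ϰ ((opR ^ l) (X 0 ^ (N - 2 * l))) v ≠ 0 := by
      by_contra! hv
      exact theta_opR_pow_X_pow_ne_zero ϰ hl (LinearMap.ext hv)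
    exact Module.End.hasEigenvalue_of_hasEigenvector
      ⟨theta_apply_mem_eigenspace ϰ hl (opR_pow_X_pow_mem_polySummand N l) v, hv⟩

/-! ## The Wedderburn decomposition -/

theorem phiIdempotent_mul_theta_self {N l : ℕ} (ϰ : Vertex N) (hl : l ≤ N / 2) {f : PolyAlg}
    (hf : f ∈ polySummand N l) : phiIdempotent N ϰ l * theta N ϰ f = theta N ϰ f :=
  LinearMap.ext fun v => (isDiagonalizableMap_phiMap ϰ).primitiveIdempotent_apply_self
    (theta_apply_mem_eigenspace ϰ hl hf v)

theorem phiIdempotent_mul_theta_of_ne {N l k : ℕ} (ϰ : Vertex N) (hl : l ≤ N / 2) (hk : k ≤ N / 2)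
    (hne : k ≠ l) {f : PolyAlg} (hf : f ∈ polySummand N k) :
    phiIdempotent N ϰ l * theta N ϰ f = 0 :=
  LinearMap.ext fun v => (isDiagonalizableMap_phiMap ϰ).primitiveIdempotent_apply_of_ne
    (fun h => hne (phiEigenvalue_injOn hk hl h)) (theta_apply_mem_eigenspace ϰ hk hf v)

theorem map_theta_polySummand {N l : ℕ} (ϰ : Vertex N) (hl : l ≤ N / 2) :
    (polySummand N l).map (theta N ϰ) = wedderburnSummand N ϰ l := by
  apply le_antisymm
  · rintro _ ⟨f, hf, rfl⟩
    exact ⟨_, theta_mem ϰ (polySummand_le hl hf), phiIdempotent_mul_theta_self ϰ hl hf⟩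
  · rintro _ ⟨t, ht, rfl⟩
    obtain ⟨h, hh, rfl⟩ := exists_sum_theta_eq ht
    refine ⟨h l, hh l hl, ?_⟩
    rw [LinearMap.mulLeft_apply, Finset.mul_sum, Finset.sum_eq_single l]
    · exact (phiIdempotent_mul_theta_self ϰ hl (hh l hl)).symm
    · intro k hk hne
      have := Finset.mem_range.1 hk
      exact phiIdempotent_mul_theta_of_ne ϰ hl (by omega) hne (hh k (by omega))
    · intro hmem
      exact absurd (Finset.mem_range.2 (by omega)) hmem

/-- With this eigenvalue equation, the two-sided ideal property follows from the centrality of `φ`.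
-/
theorem mem_wedderburnSummand_iff {N l : ℕ} {ϰ : Vertex N} (hl : l ≤ N / 2)
    {B : Module.End ℂ (StdModule N)} : B ∈ wedderburnSummand N ϰ l ↔
      B ∈ subconstituentAlgebra N ϰ ∧ phiMap N ϰ * B = phiEigenvalue N l • B := by
  constructor
  · rw [← map_theta_polySummand ϰ hl]
    rintro ⟨f, hf, rfl⟩
    exact ⟨theta_mem ϰ (polySummand_le hl hf), phiMap_mul_theta ϰ hl hf⟩
  · rintro ⟨hB, h⟩
    exact ⟨B, hB, LinearMap.ext fun v =>
      (isDiagonalizableMap_phiMap ϰ).primitiveIdempotent_apply_self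
        (Module.End.mem_eigenspace_iff.2 (LinearMap.congr_fun h v))⟩

theorem wedderburnSummand_le {N l : ℕ} {ϰ : Vertex N} (hl : l ≤ N / 2) :
    wedderburnSummand N ϰ l ≤ Subalgebra.toSubmodule (subconstituentAlgebra N ϰ) :=
  fun _ hB => ((mem_wedderburnSummand_iff hl).1 hB).1

theorem mul_mem_wedderburnSummand_left {N l : ℕ} {ϰ : Vertex N} (hl : l ≤ N / 2)
    {t B : Module.End ℂ (StdModule N)} (ht : t ∈ subconstituentAlgebra N ϰ)
    (hB : B ∈ wedderburnSummand N ϰ l) : t * B ∈ wedderburnSummand N ϰ l := by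
  rw [mem_wedderburnSummand_iff hl] at hB ⊢
  exact ⟨mul_mem ht hB.1, by rw [← mul_assoc, phiMap_mul_comm ht, mul_assoc, hB.2, mul_smul_comm]⟩

theorem mul_mem_wedderburnSummand_right {N l : ℕ} {ϰ : Vertex N} (hl : l ≤ N / 2)
    {t B : Module.End ℂ (StdModule N)} (ht : t ∈ subconstituentAlgebra N ϰ)
    (hB : B ∈ wedderburnSummand N ϰ l) : B * t ∈ wedderburnSummand N ϰ l := by
  rw [mem_wedderburnSummand_iff hl] at hB ⊢
  exact ⟨mul_mem hB.1 ht, by rw [← mul_assoc, hB.2, smul_mul_assoc]⟩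

theorem iSupIndep_wedderburnSummand {N : ℕ} (ϰ : Vertex N) :
    iSupIndep fun l : Fin (N / 2 + 1) => wedderburnSummand N ϰ l := by
  have h := (Module.End.eigenspaces_iSupIndep (LinearMap.mulLeft ℂ (phiMap N ϰ))).comp
    (f := fun l : Fin (N / 2 + 1) => phiEigenvalue N l) fun l k hlk =>
      Fin.ext (phiEigenvalue_injOn (by omega) (by omega) hlk)
  exact h.mono fun l B hB => Module.End.mem_eigenspace_iff.2
    ((mem_wedderburnSummand_iff (by omega)).1 hB).2

theorem isInternal_wedderburnSummand {N : ℕ} (ϰ : Vertex N) : DirectSum.IsInternal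
    fun l : Fin (N / 2 + 1) => (wedderburnSummand N ϰ l).submoduleOf
      (Subalgebra.toSubmodule (subconstituentAlgebra N ϰ)) := by
  refine isInternal_submoduleOf (fun l => wedderburnSummand_le (by omega))
    (iSupIndep_wedderburnSummand ϰ) fun t ht => ?_
  obtain ⟨h, hh, hs⟩ := exists_sum_theta_eq ht
  refine ⟨fun l => theta N ϰ (h l), fun l => ?_, by rw [← hs, Finset.sum_range]⟩
  rw [← map_theta_polySummand ϰ (by omega)]
  exact Submodule.mem_map_of_mem (hh l (by omega))

/-! ## Orthogonality in `End(V)` -/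

/-- The matrix entries of an endomorphism, as a vector of the Euclidean space of matrices. -/
def endCoords (N : ℕ) :
    Module.End ℂ (StdModule N) →ₗ[ℂ] EuclideanSpace ℂ (Vertex N × Vertex N) where
  toFun B := WithLp.toLp 2 fun q => B (vertexBasis N q.2) q.1
  map_add' _ _ := rfl
  map_smul' _ _ := rfl

theorem endForm_eq_inner {N : ℕ} (B C : Module.End ℂ (StdModule N)) :
    endForm B C = inner ℂ (endCoords N C) (endCoords N B) := by
  rw [PiLp.inner_apply, Fintype.sum_prod_type]
  rfl

theorem endCoords_injective (N : ℕ) : Function.Injective (endCoords N) := fun B C h =>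
  end_ext fun b c => by
    have := congr_arg (fun v : EuclideanSpace ℂ (Vertex N × Vertex N) => v (b, c)) h
    exact this

theorem sum_adjMap_mul_conj {N : ℕ} (v w : StdModule N) :
    ∑ x, adjMap N v x * starRingEnd ℂ (w x) = ∑ x, v x * starRingEnd ℂ (adjMap N w x) := by
  simp only [adjMap_apply, Finset.sum_mul, map_sum, Finset.mul_sum]
  refine Finset.sum_comm.trans ((Finset.sum_congr rfl fun i _ => ?_).trans Finset.sum_comm)
  have hinv (x : Vertex N) : flipAt (flipAt x i) i = x := by
    simp [flipAt]
  refine Finset.sum_nbij' (fun x => flipAt x i) (fun x => flipAt x i) (by simp) (by simp)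
    (fun x _ => hinv x) (fun x _ => hinv x) fun x _ => ?_
  rw [hinv]

theorem endForm_adjMap_mul {N : ℕ} (B C : Module.End ℂ (StdModule N)) :
    endForm (adjMap N * B) C = endForm B (adjMap N * C) := by
  refine Finset.sum_comm.trans ((Finset.sum_congr rfl fun y _ => ?_).trans Finset.sum_comm)
  exact sum_adjMap_mul_conj _ _

theorem endForm_mul_adjMap {N : ℕ} (B C : Module.End ℂ (StdModule N)) :
    endForm (B * adjMap N) C = endForm B (C * adjMap N) := by
  refine Finset.sum_congr rfl fun x _ => ?_
  have h := sum_adjMap_mul_conj (fun y => B (vertexBasis N y) x) fun y => C (vertexBasis N y) x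
  simp only [adjMap_apply] at h
  simpa only [Module.End.mul_apply, adjMap_vertexBasis, map_sum, Finset.sum_apply] using h

theorem conj_sub_two_mul (N d : ℕ) :
    starRingEnd ℂ ((N : ℂ) - 2 * d) = (N : ℂ) - 2 * d := by
  simp [Complex.conj_ofNat]

theorem endForm_dualAdjMap_mul {N : ℕ} (ϰ : Vertex N) (B C : Module.End ℂ (StdModule N)) :
    endForm (dualAdjMap N ϰ * B) C = endForm B (dualAdjMap N ϰ * C) := by
  refine Finset.sum_congr rfl fun x _ => Finset.sum_congr rfl fun y _ => ?_
  rw [Module.End.mul_apply, Module.End.mul_apply, dualAdjMap_apply, dualAdjMap_apply, map_mul,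
    conj_sub_two_mul]
  ring

theorem endForm_mul_dualAdjMap {N : ℕ} (ϰ : Vertex N) (B C : Module.End ℂ (StdModule N)) :
    endForm (B * dualAdjMap N ϰ) C = endForm B (C * dualAdjMap N ϰ) := by
  refine Finset.sum_congr rfl fun x _ => Finset.sum_congr rfl fun y _ => ?_
  rw [Module.End.mul_apply, Module.End.mul_apply, dualAdjMap_vertexBasis, map_smul, map_smul,
    Pi.smul_apply, Pi.smul_apply, smul_eq_mul, smul_eq_mul, map_mul, conj_sub_two_mul]
  ring

/-- Left multiplications by `A` and `A*` are self-adjoint, so their commutator is skew-adjoint and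
its square self-adjoint. Real distinct eigenvalues then give orthogonality. -/
theorem endForm_phiMap_mul {N : ℕ} (ϰ : Vertex N) (B C : Module.End ℂ (StdModule N)) :
    endForm (phiMap N ϰ * B) C = endForm B (phiMap N ϰ * C) := by
  have hA := fun B C => endForm_adjMap_mul (N := N) B C
  have hD := fun B C => endForm_dualAdjMap_mul ϰ B C
  simp only [phiMap, pow_two, smul_mul_assoc, add_mul, sub_mul, mul_sub, mul_assoc]
  simp only [endForm_eq_inner, map_smul, map_add, map_sub, inner_smul_left, inner_smul_right,
    inner_add_left, inner_add_right, inner_sub_left, inner_sub_right] at hA hD ⊢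
  simp only [hA, hD]
  simp [Complex.conj_ofNat]
  ring

theorem conj_phiEigenvalue (N l : ℕ) : starRingEnd ℂ (phiEigenvalue N l) = phiEigenvalue N l := by
  simp [phiEigenvalue, Complex.conj_ofNat]

theorem endForm_eq_zero_of_ne {N l k : ℕ} {ϰ : Vertex N} (hl : l ≤ N / 2) (hk : k ≤ N / 2)
    (hlk : l ≠ k) {B C : Module.End ℂ (StdModule N)} (hB : B ∈ wedderburnSummand N ϰ l)
    (hC : C ∈ wedderburnSummand N ϰ k) : endForm B C = 0 := by
  have h := endForm_phiMap_mul ϰ B C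
  rw [((mem_wedderburnSummand_iff hl).1 hB).2, ((mem_wedderburnSummand_iff hk).1 hC).2,
    endForm_eq_inner, endForm_eq_inner, map_smul, map_smul, inner_smul_left, inner_smul_right,
    conj_phiEigenvalue, ← sub_eq_zero, ← sub_mul] at h
  rw [endForm_eq_inner]
  exact (mul_eq_zero.1 h).resolve_left
    (sub_ne_zero.2 fun h => hlk (phiEigenvalue_injOn hl hk h))

/-! ## Minimality of the Wedderburn summands -/

/-- A subspace of `End(V)` is a `T`-bimodule if it is stable under left and right multiplication
by `A` and `A*`. -/
structure IsBistable {N : ℕ} (ϰ : Vertex N) (K : Submodule ℂ (Module.End ℂ (StdModule N))) :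
    Prop where
  adj_mul : ∀ B ∈ K, adjMap N * B ∈ K
  mul_adj : ∀ B ∈ K, B * adjMap N ∈ K
  dual_mul : ∀ B ∈ K, dualAdjMap N ϰ * B ∈ K
  mul_dual : ∀ B ∈ K, B * dualAdjMap N ϰ ∈ K

theorem IsBistable.theta_mem {N l : ℕ} {ϰ : Vertex N} (hl : l ≤ N / 2)
    {K : Submodule ℂ (Module.End ℂ (StdModule N))} (hK : IsBistable ϰ K)
    (hle : K ≤ wedderburnSummand N ϰ l) (h0 : K ≠ ⊥) :
    theta N ϰ ((opR ^ l) (X 0 ^ (N - 2 * l))) ∈ K := by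
  -- Injectivity of `ϑ` on `P_N` brings raised polynomials back into the `l`-th summand.
  have hlift {f : PolyAlg} (hf : f ∈ homPoly N) (hfK : theta N ϰ f ∈ K) :
      f ∈ polySummand N l := by
    have := hle hfK
    rw [← map_theta_polySummand ϰ hl] at this
    obtain ⟨g, hg, hgf⟩ := this
    rwa [← theta_injOn ϰ (polySummand_le hl hg) hf hgf]
  let S₀ : Submodule ℂ PolyAlg := K.comap (theta N ϰ)
  have hL : ∀ f ∈ S₀, leftRaise f ∈ S₀ := fun f hf => leftRaise_mem_of_stable
    (fun f hf => by rw [Submodule.mem_comap, theta_leftAdj]; exact hK.adj_mul _ hf)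
    (fun f hf => by rw [Submodule.mem_comap, theta_leftDual]; exact hK.dual_mul _ hf) hf
  have hR : ∀ f ∈ S₀, rightRaise f ∈ S₀ := fun f hf => rightRaise_mem_of_stable
    (fun f hf => by rw [Submodule.mem_comap, theta_rightAdj]; exact hK.mul_adj _ hf)
    (fun f hf => by rw [Submodule.mem_comap, theta_rightDual]; exact hK.mul_dual _ hf) hf
  -- The intersection is needed because `S₀` also contains every component of degree other than `N`,
  -- on which `theta` vanishes.
  have hmem := opR_pow_X_pow_mem (S := S₀ ⊓ polySummand N l) inf_le_right ?_ ?_ ?_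
  · exact hmem.1
  · obtain ⟨B, hB, hB0⟩ := K.ne_bot_iff.1 h0
    have := hle hB
    rw [← map_theta_polySummand ϰ hl] at this
    obtain ⟨f, hf, rfl⟩ := this
    refine (Submodule.ne_bot_iff _).2 ⟨f, ⟨hB, hf⟩, ?_⟩
    rintro rfl
    exact hB0 (map_zero _)
  · exact fun f hf => ⟨hL f hf.1, hlift (add_mem (xD_mem _ _ (polySummand_le hl hf.2))
      (xD_mem _ _ (polySummand_le hl hf.2))) (hL f hf.1)⟩
  · exact fun f hf => ⟨hR f hf.1, hlift (add_mem (xD_mem _ _ (polySummand_le hl hf.2))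
      (xD_mem _ _ (polySummand_le hl hf.2))) (hR f hf.1)⟩

theorem IsBistable.eq_wedderburnSummand {N l : ℕ} {ϰ : Vertex N} (hl : l ≤ N / 2)
    {K : Submodule ℂ (Module.End ℂ (StdModule N))} (hK : IsBistable ϰ K)
    (hle : K ≤ wedderburnSummand N ϰ l) (h0 : K ≠ ⊥) : K = wedderburnSummand N ϰ l := by
  have hA : adjMap N ∈ subconstituentAlgebra N ϰ := Algebra.subset_adjoin (by simp)
  have hD : dualAdjMap N ϰ ∈ subconstituentAlgebra N ϰ := Algebra.subset_adjoin (by simp)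
  let K' : Submodule ℂ (Module.End ℂ (StdModule N)) :=
    (K.map (endCoords N))ᗮ.comap (endCoords N) ⊓ wedderburnSummand N ϰ l
  have hmem (B : Module.End ℂ (StdModule N)) :
      B ∈ K' ↔ (∀ C ∈ K, endForm B C = 0) ∧ B ∈ wedderburnSummand N ϰ l := by
    simp [K', Submodule.mem_orthogonal, endForm_eq_inner]
  have hK' : IsBistable ϰ K' := by
    constructor <;> intro B hB <;> rw [hmem] at hB ⊢
    · exact ⟨fun C hC => by rw [endForm_adjMap_mul]; exact hB.1 _ (hK.adj_mul _ hC),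
        mul_mem_wedderburnSummand_left hl hA hB.2⟩
    · exact ⟨fun C hC => by rw [endForm_mul_adjMap]; exact hB.1 _ (hK.mul_adj _ hC),
        mul_mem_wedderburnSummand_right hl hA hB.2⟩
    · exact ⟨fun C hC => by rw [endForm_dualAdjMap_mul]; exact hB.1 _ (hK.dual_mul _ hC),
        mul_mem_wedderburnSummand_left hl hD hB.2⟩
    · exact ⟨fun C hC => by rw [endForm_mul_dualAdjMap]; exact hB.1 _ (hK.mul_dual _ hC),
        mul_mem_wedderburnSummand_right hl hD hB.2⟩
  have hbot : K' = ⊥ := by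
    by_contra hne
    have h1 := hK.theta_mem hl hle h0
    -- The same highest weight vector lies in `K` and in its orthogonal complement, so it has norm
    -- zero.
    have h2 := ((hmem _).1 (hK'.theta_mem hl inf_le_right hne)).1 _ h1
    rw [endForm_eq_inner, inner_self_eq_zero] at h2
    exact theta_opR_pow_X_pow_ne_zero ϰ hl (endCoords_injective N (h2.trans (map_zero _).symm))
  refine le_antisymm hle fun B hB => ?_
  have hsup := Submodule.sup_orthogonal_inf_of_hasOrthogonalProjection
    (Submodule.map_mono (f := endCoords N) hle)
  have hB' : endCoords N B ∈ (wedderburnSummand N ϰ l).map (endCoords N) :=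
    Submodule.mem_map_of_mem hB
  rw [← hsup] at hB'
  obtain ⟨_, ⟨k, hk, rfl⟩, _, ⟨ho, c, hc, rfl⟩, hs⟩ := Submodule.mem_sup.1 hB'
  rw [← map_add] at hs
  have hcK : c ∈ K' := ⟨ho, hc⟩
  rw [hbot, Submodule.mem_bot] at hcK
  rw [← endCoords_injective N hs, hcK, add_zero]
  exact hk

theorem exists_isAtom_wedderburnSummand {N l : ℕ} (ϰ : Vertex N) (hl : l ≤ N / 2) :
    ∃ J : TwoSidedIdeal (subconstituentAlgebra N ϰ), IsAtom J ∧
      ∀ B : subconstituentAlgebra N ϰ,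
        B ∈ J ↔ (B : Module.End ℂ (StdModule N)) ∈ wedderburnSummand N ϰ l := by
  let J : TwoSidedIdeal (subconstituentAlgebra N ϰ) :=
    TwoSidedIdeal.mk' {B | (B : Module.End ℂ (StdModule N)) ∈ wedderburnSummand N ϰ l}
      (zero_mem (wedderburnSummand N ϰ l)) (fun hx hy => (wedderburnSummand N ϰ l).add_mem hx hy)
      (fun hx => (wedderburnSummand N ϰ l).neg_mem hx)
      (fun {x _} hy => mul_mem_wedderburnSummand_left hl x.2 hy)
      (fun {_ y} hx => mul_mem_wedderburnSummand_right hl y.2 hx)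
  have hJ (B : subconstituentAlgebra N ϰ) :
      B ∈ J ↔ (B : Module.End ℂ (StdModule N)) ∈ wedderburnSummand N ϰ l :=
    TwoSidedIdeal.mem_mk' _ _ _ _ _ _ _
  refine ⟨J, isAtom_iff_le_of_ge.2 ⟨?_, fun I hI hIJ => ?_⟩, hJ⟩
  · intro hbot
    have hs := opR_pow_X_pow_mem_polySummand N l
    have hm : (⟨_, theta_mem ϰ (polySummand_le hl hs)⟩ : subconstituentAlgebra N ϰ) ∈ J := by
      rw [hJ, ← map_theta_polySummand ϰ hl]
      exact Submodule.mem_map_of_mem hs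
    rw [hbot, TwoSidedIdeal.mem_bot] at hm
    exact theta_opR_pow_X_pow_ne_zero ϰ hl (congr_arg Subtype.val hm)
  · have hA : adjMap N ∈ subconstituentAlgebra N ϰ := Algebra.subset_adjoin (by simp)
    have hD : dualAdjMap N ϰ ∈ subconstituentAlgebra N ϰ := Algebra.subset_adjoin (by simp)
    -- Scalars lie in the unital algebra `T`, so a two-sided ideal is automatically a complex
    -- subspace.
    let K₀ : Submodule ℂ (subconstituentAlgebra N ϰ) :=
      { carrier := {B | B ∈ I}
        add_mem' := fun ha hb => I.add_mem ha hb
        zero_mem' := I.zero_mem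
        smul_mem' := fun c B hB => by
          rw [Set.mem_ofPred_eq, Algebra.smul_def]
          exact I.mul_mem_left _ _ hB }
    let K := K₀.map (subconstituentAlgebra N ϰ).val.toLinearMap
    have hK : IsBistable ϰ K := by
      constructor <;> rintro _ ⟨B, hB, rfl⟩
      · exact ⟨⟨_, hA⟩ * B, I.mul_mem_left _ _ hB, rfl⟩
      · exact ⟨B * ⟨_, hA⟩, I.mul_mem_right _ _ hB, rfl⟩
      · exact ⟨⟨_, hD⟩ * B, I.mul_mem_left _ _ hB, rfl⟩
      · exact ⟨B * ⟨_, hD⟩, I.mul_mem_right _ _ hB, rfl⟩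
    have hle : K ≤ wedderburnSummand N ϰ l := by
      rintro _ ⟨B, hB, rfl⟩
      exact (hJ B).1 (hIJ hB)
    have h0 : K ≠ ⊥ := by
      intro hbot
      refine hI (TwoSidedIdeal.ext fun B => ⟨fun hB => ?_, fun hB => ?_⟩)
      · have : (B : Module.End ℂ (StdModule N)) ∈ K := ⟨B, hB, rfl⟩
        rw [hbot, Submodule.mem_bot] at this
        exact (TwoSidedIdeal.mem_bot _).2 (Subtype.ext this)
      · rw [(TwoSidedIdeal.mem_bot _).1 hB]
        exact I.zero_mem
    intro B hB
    have hBK := (hJ B).1 hB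
    rw [← hK.eq_wedderburnSummand hl hle h0] at hBK
    obtain ⟨C, hC, hCB⟩ := hBK
    rwa [← Subtype.ext hCB]

theorem map_vartheta_submoduleOf {N : ℕ} (ϰ : Vertex N) {S : Submodule ℂ PolyAlg}
    (hS : S ≤ homPoly N) : (S.submoduleOf (homPoly N)).map (vartheta N ϰ) = S.map (theta N ϰ) := by
  ext B
  constructor
  · rintro ⟨f, hf, rfl⟩
    exact ⟨f, hf, rfl⟩
  · rintro ⟨f, hf, rfl⟩
    exact ⟨⟨f, hS hf⟩, hf, rfl⟩

theorem mainTheorem3 (N : ℕ) (ϰ : Vertex N) :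
    -- `ϑ` is a bijective linear map from `P_N` onto `T`
    (Function.Injective (vartheta N ϰ) ∧
      LinearMap.range (vartheta N ϰ) =
        Subalgebra.toSubmodule (subconstituentAlgebra N ϰ)) ∧
    -- `ϑ` maps the `ℓ`-summand of `P_N` onto `φ_ℓ T`
    (∀ l : ℕ, l ≤ N / 2 →
      polySummand N l ≤ homPoly N ∧
      ((polySummand N l).submoduleOf (homPoly N)).map (vartheta N ϰ) =
        wedderburnSummand N ϰ l) ∧
    -- the orthogonal direct sum decomposition of `P_N`
    (DirectSum.IsInternal
        (fun l : Fin (N / 2 + 1) => (polySummand N l).submoduleOf (homPoly N)) ∧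
      ∀ l k : ℕ, l ≤ N / 2 → k ≤ N / 2 → l ≠ k →
        ∀ f ∈ polySummand N l, ∀ g ∈ polySummand N k, polyForm f g = 0) ∧
    -- `φ` is diagonalizable with eigenvalues `(N - 2ℓ)(N - 2ℓ + 2) / 2` for `0 ≤ ℓ ≤ ⌊N/2⌋`
    (IsDiagonalizableMap (phiMap N ϰ) ∧
      ∀ μ : ℂ, (phiMap N ϰ).HasEigenvalue μ ↔ ∃ l : ℕ, l ≤ N / 2 ∧ μ = phiEigenvalue N l) ∧
    -- the Wedderburn decomposition of `T`: an orthogonal direct sum of minimal two-sided ideals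
    (DirectSum.IsInternal
        (fun l : Fin (N / 2 + 1) => (wedderburnSummand N ϰ l).submoduleOf
          (Subalgebra.toSubmodule (subconstituentAlgebra N ϰ))) ∧
      (∀ l k : ℕ, l ≤ N / 2 → k ≤ N / 2 → l ≠ k →
        ∀ B ∈ wedderburnSummand N ϰ l, ∀ C ∈ wedderburnSummand N ϰ k, endForm B C = 0) ∧
      ∀ l : ℕ, l ≤ N / 2 →
        ∃ J : TwoSidedIdeal (subconstituentAlgebra N ϰ), IsAtom J ∧
          ∀ B : subconstituentAlgebra N ϰ,
            B ∈ J ↔ (B : Module.End ℂ (StdModule N)) ∈ wedderburnSummand N ϰ l) := by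

  refine ⟨⟨fun f g h => Subtype.ext (theta_injOn ϰ f.2 g.2 h), ?_⟩,
    fun l hl => ⟨polySummand_le hl, ?_⟩,
    ⟨isInternal_polySummand N, fun l k _ _ hlk f hf g hg => polyForm_eq_zero_of_ne hlk hf hg⟩,
    ⟨isDiagonalizableMap_phiMap ϰ, hasEigenvalue_phiMap_iff ϰ⟩,
    ⟨isInternal_wedderburnSummand ϰ,
      fun l k hl hk hlk B hB C hC => endForm_eq_zero_of_ne hl hk hlk hB hC,
      fun l hl => exists_isAtom_wedderburnSummand ϰ hl⟩⟩
  · rw [← map_theta_homPoly, ← map_vartheta_submoduleOf ϰ le_rfl, Submodule.submoduleOf_self,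
      Submodule.map_top]
  · rw [map_vartheta_submoduleOf ϰ (polySummand_le hl), map_theta_polySummand ϰ hl]

end
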